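/- Let $\mathfrak S_3$ act on $\mathbb R^3$ by permuting the canonical basis, let $o=(\sqrt2,0,-\sqrt2)$, and let $C=\mathrm{conv}\{u(o) : u\in\mathfrak S_3\}$, a regular hexagon. Write $s_k=(k\ k{+}1)$ and, for $u\in\mathfrak S_3$ and $X\subseteq\{s_1,s_2\}$, let $F(u,X)=\mathrm{conv}\{u v(o) : v\in\langle X\rangle\}$; these are the faces of $C$ (including $C$ itself). Let $P(u,X)$ be the ordered partition of $\{1,2,3\}$ obtained by cutting the word $u(1)u(2)u(3)$ after its $k$-th letter for each $s_k\notin X$. The BEER complex $\Omega_3$ is the quotient of six hexagons $C\times\mathfrak S_3$ by the equivalence relation generated by the following identifications. Whenever $P(u,X)$ and $P(v,Y)$ agree up to the order of their blocks, and $w(i)<w(j)\Leftrightarrow w'(i)<w'(j)$ for all $i,j$ in a common block, the face $(F(u,X),w)$ is identified with $(F(v,Y),w')$ by $(x,w)\sim(x+v(o)-u(o),w')$, where $u$ and $v$ are the elements of minimal length of $u\langle X\rangle$ and $v\langle Y\rangle$. Give $\Omega_3$ the quotient metric of the Euclidean metrics of the hexagons (infimum of the lengths of strings). For a point $p$ of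 $\Omega_3$, the link $\mathrm{Lk}(p)$ is the set of unit vectors $d$ based at points $(x,w)$ over $p$ and pointing into $C$, two of them being identified when the initial segments $t\mapsto(x+td,w)$ agree in $\Omega_3$ for all small $t>0$. It carries the quotient metric of the angular metrics. For $i\ne j$ let $D^1(i,j)$ be the class of the edges $[u(o),us_k(o)]$ in the cells $w$ with $\{u(k),u(k+1)\}=\{i,j\}$ and $w(i)<w(j)$, oriented from the endpoint where $i$ precedes $j$ to the endpoint where $j$ precedes $i$. Let $y^-(i,j)$ and $y^+(i,j)$ be the points of the link of the vertex determined by the source and by the target of $D^1(i,j)$. **Theorem.** $\Omega_3$ is not locally CAT(0), that is, some point of $\Omega_3$ has no open ball around it which is a CAT(0) space for the induced metric. Moreover: 1. $\Omega_3$ has exactly one vertex $\omega^0$, and the points $y^+(1,2)$ and $y^-(1,3)$ of $\mathrm{Lk}(\omega^0)$ are well defined. 2. The corners at the vertex $u(o)$, $u=(1\,2)$, of the hexagons $w=\mathrm{id}$ and $w=(2\,3)$ contribute to $\mathrm{Lk}(\omega^0)$ two edges $A_1,A_2$. Each is the image of a geodesic of length $2\pi/3$ from $y^+(1,2)$ to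 $y^-(1,3)$, and $A_1\cap A_2=\{y^+(1,2),y^-(1,3)\}$. 3. $A_1\cup A_2$ is the image of a closed geodesic (a locally isometric map from a circle) of length $4\pi/3<2\pi$ in $\mathrm{Lk}(\omega^0)$ which is not null-homotopic. Hence $\Omega_3$ violates the link condition that, in the link of every vertex, every closed geodesic that is not null-homotopic has length at least $2\pi$. -/

import Mathlib

open Set Filter Topology
open scoped ENNReal

noncomputable section

namespace BEER

/-! ### Quotient (pseudo-)metrics, given by lengths of strings -/

section Strings

variable {A Q : Type*}

/-- `IsString π c x y L`: the points `x` and `y` of `Q` are joined by a string of total length `L`,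
that is, there are `a₀, b₀, a₁, b₁, …, aₘ, bₘ` in `A` with `π a₀ = x`, `π bᵢ = π aᵢ₊₁`, `π bₘ = y` and
`L = c a₀ b₀ + ⋯ + c aₘ bₘ`. -/
inductive IsString (π : A → Q) (c : A → A → ℝ≥0∞) : Q → Q → ℝ≥0∞ → Prop
  | single (a b : A) : IsString π c (π a) (π b) (c a b)
  | snoc {x : Q} {L : ℝ≥0∞} (a b : A) (h : IsString π c x (π a) L) :
      IsString π c x (π b) (L + c a b)

theorem IsString.trans {π : A → Q} {c : A → A → ℝ≥0∞} {x y z : Q} {L M : ℝ≥0∞}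
    (h : IsString π c x y L) (h' : IsString π c y z M) : IsString π c x z (L + M) := by
  induction h' with
  | single a b => exact IsString.snoc a b h
  | snoc a b _ ih => rw [← add_assoc]; exact IsString.snoc a b (ih h)

theorem IsString.symm {π : A → Q} {c : A → A → ℝ≥0∞} (hc : ∀ a b, c a b = c b a) {x y : Q}
    {L : ℝ≥0∞} (h : IsString π c x y L) : IsString π c y x L := by
  induction h with
  | single a b => rw [hc a b]; exact IsString.single b a
  | snoc a b _ ih => rw [hc a b, add_comm]; exact (IsString.single b a).trans ih

/-- The quotient distance: the infimum of the lengths of the strings from `x` to `y`. -/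
def stringEDist (π : A → Q) (c : A → A → ℝ≥0∞) (x y : Q) : ℝ≥0∞ :=
  sInf {L | IsString π c x y L}

/-- The quotient pseudo-metric on `Q` induced by a distance `c` on `A` along `π : A → Q`. -/
@[reducible]
def stringPseudoEMetric (π : A → Q) (c : A → A → ℝ≥0∞) (hπ : Function.Surjective π)
    (h0 : ∀ a, c a a = 0) (hc : ∀ a b, c a b = c b a) : PseudoEMetricSpace Q where
  edist := stringEDist π c
  edist_self x := by
    obtain ⟨a, rfl⟩ := hπ x
    refine le_antisymm (sInf_le ?_) bot_le
    have h := IsString.single (π := π) (c := c) a a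
    rwa [h0 a] at h
  edist_comm x y := by
    change sInf _ = sInf _
    congr 1
    ext L
    exact ⟨fun h => h.symm hc, fun h => h.symm hc⟩
  edist_triangle x y z := by
    change sInf _ ≤ sInf _ + sInf _
    rw [ENNReal.sInf_add]
    refine le_iInf₂ fun L hL => ?_
    rw [add_comm, ENNReal.sInf_add]
    refine le_iInf₂ fun M hM => ?_
    rw [add_comm]
    exact sInf_le (IsString.trans hL hM)

end Strings

/-! ### Geodesics and the CAT(0) condition -/

section CAT0

variable {X : Type*} [PseudoEMetricSpace X]

/-- The restriction of `γ` to `[0, ℓ]` is a geodesic of length `ℓ` from `x` to `y`. -/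
def IsGeodesic (γ : ℝ → X) (ℓ : ℝ) (x y : X) : Prop :=
  0 ≤ ℓ ∧ γ 0 = x ∧ γ ℓ = y ∧
    ∀ s ∈ Icc 0 ℓ, ∀ t ∈ Icc 0 ℓ, edist (γ s) (γ t) = ENNReal.ofReal |s - t|

/-- `X` is a CAT(0) space: any two points are joined by a geodesic, and geodesic triangles are not
thicker than their comparison triangles `x' y' z'` in the Euclidean plane.
Any two sides of a triangle meet in a vertex, here called `x`; `p` and `q` are arbitrary points of
the sides `[x, y]` and `[x, z]`, with comparison points `p'` and `q'`. Separation of points is not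
demanded, so that for a metric space this is the usual notion, and otherwise a weaker one. -/
def IsCAT0 (X : Type*) [PseudoEMetricSpace X] : Prop :=
  (∀ x y : X, ∃ (γ : ℝ → X) (ℓ : ℝ), IsGeodesic γ ℓ x y) ∧
  ∀ (x y z : X) (γ₁ γ₂ : ℝ → X) (ℓ₁ ℓ₂ : ℝ), IsGeodesic γ₁ ℓ₁ x y → IsGeodesic γ₂ ℓ₂ x z →
    ∀ x' y' z' : EuclideanSpace ℝ (Fin 2),
      edist x' y' = edist x y → edist x' z' = edist x z → edist y' z' = edist y z →
      ∀ s ∈ Icc 0 ℓ₁, ∀ t ∈ Icc 0 ℓ₂,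
        ∀ p' ∈ segment ℝ x' y', ∀ q' ∈ segment ℝ x' z', dist x' p' = s → dist x' q' = t →
          edist (γ₁ s) (γ₂ t) ≤ edist p' q'

/-- `X` is locally CAT(0): every point has an open ball which, with the induced metric, is
CAT(0). -/
def IsLocallyCAT0 (X : Type*) [PseudoEMetricSpace X] : Prop :=
  ∀ x : X, ∃ r : ℝ, 0 < r ∧ IsCAT0 (Metric.eball x (ENNReal.ofReal r))

/-- A closed geodesic of length `L`: a locally isometric map from the circle `ℝ / Lℤ` of
length `L`. -/
def IsClosedGeodesic {L : ℝ} (c : C(AddCircle L, X)) : Prop :=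
  ∀ θ : AddCircle L, ∃ ε > 0, ∀ s ∈ Metric.ball θ ε, ∀ t ∈ Metric.ball θ ε,
    edist (c s) (c t) = edist s t

end CAT0

/-! ### The permutohedron and its faces -/

section Permutohedron

variable {n : ℕ}

/-- The Euclidean space in which the permutohedron lives. -/
abbrev E (n : ℕ) : Type := EuclideanSpace ℝ (Fin n)

/-- The action of the symmetric group by permutation of the canonical basis, `u (e_j) = e_{u j}`. -/
def act (u : Equiv.Perm (Fin n)) (x : E n) : E n := WithLp.toLp 2 fun i => x (u⁻¹ i)

/-- The base point `o = ∑_{j = 1}^{n} (n + 1 - 2 j) / √2 • e_j` (here the index starts at `0`). -/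
def basePoint (n : ℕ) : E n :=
  WithLp.toLp 2 fun j => ((n : ℝ) - 1 - 2 * ((j : ℕ) : ℝ)) / √2

/-- The vertex `u(o)` of the permutohedron. -/
def vertex (u : Equiv.Perm (Fin n)) : E n := act u (basePoint n)

/-- The permutohedron, the convex hull of the orbit of `o`. For `n = 3` it is a regular hexagon. -/
def permutohedron (n : ℕ) : Set (E n) := convexHull ℝ (range (vertex (n := n)))

/-- The left one of the two positions exchanged by the `k`-th simple transposition. -/
def lo (k : Fin (n - 1)) : Fin n := ⟨k, by omega⟩

/-- The right one of the two positions exchanged by the `k`-th simple transposition. -/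
def hi (k : Fin (n - 1)) : Fin n := ⟨k + 1, by omega⟩

/-- The simple transposition `s_k`. -/
def simple (k : Fin (n - 1)) : Equiv.Perm (Fin n) := Equiv.swap (lo k) (hi k)

/-- The standard parabolic subgroup `W_X`. -/
def parabolic (X : Set (Fin (n - 1))) : Subgroup (Equiv.Perm (Fin n)) :=
  Subgroup.closure (simple '' X)

/-- The face `F(u, X)`, the convex hull of the points `u w (o)` with `w` in `W_X`. -/
def face (u : Equiv.Perm (Fin n)) (X : Set (Fin (n - 1))) : Set (E n) :=
  convexHull ℝ ((fun w => vertex (u * w)) '' (parabolic X : Set (Equiv.Perm (Fin n))))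

/-- The unordered partition underlying the ordered partition `P(u, X)`. The blocks of `P(u, X)` are
obtained by cutting the word `u(1) u(2) ⋯ u(n)` after the `k`-th letter for every `s_k` not in `X`,
so that `a` and `b` are in the same block iff no such cut separates them. -/
def blocks (u : Equiv.Perm (Fin n)) (X : Set (Fin (n - 1))) : Setoid (Fin n) where
  r a b := ∀ k ∉ X, (u⁻¹ a ≤ lo k ↔ u⁻¹ b ≤ lo k)
  iseqv := ⟨fun _ _ _ => Iff.rfl, fun h k hk => (h k hk).symm,
    fun h h' k hk => (h k hk).trans (h' k hk)⟩

/-- `u` is the element of minimal length of the coset `u W_X`, which means that the word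
`u(1) u(2) ⋯ u(n)` increases at every simple transposition in `X`. -/
def IsMinimal (u : Equiv.Perm (Fin n)) (X : Set (Fin (n - 1))) : Prop :=
  ∀ k ∈ X, u (lo k) < u (hi k)

end Permutohedron

/-! ### The BEER complex -/

section Complex

variable {n : ℕ}

/-- The disjoint union of the copies of the permutohedron indexed by the symmetric group. -/
abbrev Cells (n : ℕ) : Type := permutohedron n × Equiv.Perm (Fin n)

/-- The identification of the face `(F(u, X), w)` with the face `(F(v, Y), w')`, for `u` and `v` of
minimal length in `u W_X` and `v W_Y`: it is made when `P(u, X)` and `P(v, Y)` are the same up to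
the order of the blocks and `w`, `w'` order each block in the same way, and it is the translation of
vector `v(o) - u(o)`. -/
def Glue (p q : Cells n) : Prop :=
  ∃ (u v : Equiv.Perm (Fin n)) (X Y : Set (Fin (n - 1))),
    IsMinimal u X ∧ IsMinimal v Y ∧ blocks u X = blocks v Y ∧
    (∀ i j, blocks u X i j → (p.2 i < p.2 j ↔ q.2 i < q.2 j)) ∧
    (p.1 : E n) ∈ face u X ∧ (q.1 : E n) = p.1 + (vertex v - vertex u)

/-- The BEER complex `Ω_n`, the quotient of the disjoint union of the permutohedra by the equivalence
relation generated by the identifications of faces. -/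
def Omega (n : ℕ) : Type := Quot (Glue (n := n))

/-- The quotient map onto the BEER complex. -/
def toOmega (p : Cells n) : Omega n := Quot.mk _ p

/-- The Euclidean distance on each copy of the permutohedron; distinct copies are at infinite
distance. -/
def cellEDist (p q : Cells n) : ℝ≥0∞ :=
  open Classical in if p.2 = q.2 then edist p.1 q.1 else ⊤

/-- The metric of `Ω_n` induced by the Euclidean metric of the permutohedron. -/
instance : PseudoEMetricSpace (Omega n) :=
  stringPseudoEMetric toOmega cellEDist Quot.mk_surjective
    (fun a => by simp [cellEDist]) (fun a b => by simp [cellEDist, edist_comm, eq_comm])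

/-- `p` is a vertex (a `0`-cell) of `Ω_n`. -/
def IsVertex (p : Omega n) : Prop :=
  ∃ a : Cells n, toOmega a = p ∧ ∃ u, (a.1 : E n) = vertex u

end Complex

/-! ### The geometric link of a point -/

section Link

variable {n : ℕ}

/-- A unit vector `dir` at a point `base` of the cell `cell`, pointing into the cell, where the point
of the cell lies over `p`. -/
structure PreLink (p : Omega n) where
  cell : Equiv.Perm (Fin n)
  base : permutohedron n
  toOmega_eq : toOmega (base, cell) = p
  dir : E n
  norm_dir : ‖dir‖ = 1
  inward : ∀ᶠ t in 𝓝[>] (0 : ℝ), (base : E n) + t • dir ∈ permutohedron n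

/-- Two directions are identified iff initial segments in these directions agree in `Ω_n`. -/
def germSetoid (p : Omega n) : Setoid (PreLink p) where
  r a b := ∀ᶠ t in 𝓝[>] (0 : ℝ), ∃ (ha : (a.base : E n) + t • a.dir ∈ permutohedron n)
    (hb : (b.base : E n) + t • b.dir ∈ permutohedron n),
      toOmega (⟨_, ha⟩, a.cell) = toOmega (⟨_, hb⟩, b.cell)
  iseqv := by
    refine ⟨fun a => ?_, fun {a b} h => ?_, fun {a b c} h h' => ?_⟩
    · filter_upwards [a.inward] with t ht using ⟨ht, ht, rfl⟩
    · filter_upwards [h] with t ht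
      obtain ⟨ha, hb, e⟩ := ht
      exact ⟨hb, ha, e.symm⟩
    · filter_upwards [h, h'] with t ht ht'
      obtain ⟨ha, hb, e⟩ := ht
      obtain ⟨_, hc, e'⟩ := ht'
      exact ⟨ha, hc, e.trans e'⟩

/-- The geometric link `Lk(p, Ω_n)`. -/
def Link (p : Omega n) : Type := Quotient (germSetoid p)

/-- The point of the link given by a direction in a cell. -/
def toLink {p : Omega n} (a : PreLink p) : Link p := Quotient.mk (germSetoid p) a

/-- The angle between two directions at the same point of the same cell. -/
def angleEDist {p : Omega n} (a b : PreLink p) : ℝ≥0∞ :=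
  open Classical in
  if a.cell = b.cell ∧ a.base = b.base then
    ENNReal.ofReal (InnerProductGeometry.angle a.dir b.dir) else ⊤

/-- The metric (and with it the topology) of the link, induced by the angular metrics of the links
in the cells. -/
instance (p : Omega n) : PseudoEMetricSpace (Link p) :=
  stringPseudoEMetric toLink angleEDist Quotient.mk_surjective
    (fun a => by
      have h : a.dir ≠ 0 := fun h => by simpa [h] using a.norm_dir
      simp [angleEDist, InnerProductGeometry.angle_self h])
    (fun a b => by simp [angleEDist, InnerProductGeometry.angle_comm, eq_comm])

/-- The part of the link contributed by the corner at the vertex `u(o)` of the cell `w`. For `n = 3`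
these are the edges of the link of the vertex. -/
def linkCorner (p : Omega n) (w u : Equiv.Perm (Fin n)) : Set (Link p) :=
  {y | ∃ a : PreLink p, toLink a = y ∧ a.cell = w ∧ (a.base : E n) = vertex u}

/-- `y` is the direction at the vertex `u(o)` of the edge `[u(o), u s_k (o)]` in the cell `w`. -/
def IsEdgeDirection {p : Omega n} (y : Link p) (w u : Equiv.Perm (Fin n)) (k : Fin (n - 1)) : Prop :=
  ∃ a : PreLink p, toLink a = y ∧ a.cell = w ∧ (a.base : E n) = vertex u ∧
    ∃ r : ℝ, 0 < r ∧ a.dir = r • (vertex (u * simple k) - vertex u)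

/-- `y` is the point `y⁻(i, j)` of the link, determined by the source of the edge `D¹(i, j)`. This edge
is the class of the edges with block `{i, j}` in the cells `w` with `w i < w j`, oriented from the
endpoint at which `i` comes before `j` to the endpoint at which `j` comes before `i`. -/
def IsYMinus {p : Omega n} (i j : Fin n) (y : Link p) : Prop :=
  ∃ w u k, IsEdgeDirection y w u k ∧ w i < w j ∧ u (lo k) = i ∧ u (hi k) = j

/-- `y` is the point `y⁺(i, j)` of the link, determined by the target of the edge `D¹(i, j)`. -/
def IsYPlus {p : Omega n} (i j : Fin n) (y : Link p) : Prop :=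
  ∃ w u k, IsEdgeDirection y w u k ∧ w i < w j ∧ u (lo k) = j ∧ u (hi k) = i

/-- The arc `A` is the image of a geodesic of length `ℓ` from `y` to `y'`. -/
def IsArc {X : Type*} [PseudoEMetricSpace X] (A : Set X) (ℓ : ℝ) (y y' : X) : Prop :=
  ∃ γ : ℝ → X, IsGeodesic γ ℓ y y' ∧ γ '' Icc 0 ℓ = A

/-- The link condition for `Ω_n`: in the link of every vertex, each closed geodesic which is not
homotopically trivial has length at least `2π`. -/
def LinkCondition (n : ℕ) : Prop :=
  ∀ p : Omega n, IsVertex p → ∀ L : ℝ, 0 < L → ∀ c : C(AddCircle L, Link p),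
    IsClosedGeodesic c → ¬ c.Nullhomotopic → 2 * Real.pi ≤ L

end Link

end BEER

end

/-!
# The BEER complex `Ω₃` is not locally CAT(0)

The corner with word `213` occurs in the cells `w = 1` and `w = (2 3)`. In both cells the two
edges at this corner are the edges `D¹(1, 2)`, at its target, and `D¹(1, 3)`, at its source,
because `w` orders the pairs `{1, 2}` and `{1, 3}` in the same way. So the two hexagons are
glued along both edges of a corner, and in the link of the unique vertex the two corresponding
edges, of length `2π/3`, have the same endpoints. They form a closed curve of length `4π/3`,
which is less than `2π`. Near the vertex, the segments cutting off this corner in the two hexagons have the same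
endpoints; they are geodesics, and their midpoints differ, which is impossible in a CAT(0)
space. In the Lean text letters are numbered from `0`.

The identifications are made explicit by the relation `Rel` in coordinates, where the hexagon
lies in `{x 0 + x 1 + x 2 = 0, |x i| ≤ √2}`: an edge is given by `x l = ± √2`, and the glueing
of two edges with block `{i, j}` preserves `x i - x j` (`toOmega_eq_imp`, `EdgeRel.toOmega_eq`).
The consequence for the link is `eq_or_linkRel_of_toLink_eq`: only directions of edges are
identified.

Upper bounds of the quotient metrics are given by strings with one piece. For the lower bounds,
a function on the quotient that is `1`-Lipschitz on every cell is `1`-Lipschitz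
(`edist_le_stringEDist`), and suitable functions are written down:
* in `Ω₃`, `tentDiff` shows that the segments are geodesics, and `boundaryDist` separates their
  midpoints (`not_isLocallyCAT0`);
* in the link, `startDist` shows that the two arcs are geodesics (`isGeodesic_arc`), and
  `arcTentDiff` that the closed curve is locally isometric at the common endpoints
  (`isClosedGeodesic_loop`).

The closed curve is not null-homotopic (`not_nullhomotopic_loop`): the link is mapped to a
circle by wrapping one of the arcs around it and collapsing all the other edges. A
null-homotopic curve would become a curve in the circle that lifts to a closed curve in the
line, but the lift of the image of the curve gains a full turn.
-/

noncomputable section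

namespace BEER

/-! ### Coordinates of the hexagon -/

theorem sqrt_two_mul_self : √2 * √2 = 2 := Real.mul_self_sqrt (by norm_num)

theorem vertex_apply (u : Equiv.Perm (Fin 3)) (i : Fin 3) :
    vertex u i = √2 * (1 - ((u⁻¹ i : Fin 3) : ℕ)) := by
  have h : (√2 : ℝ) ≠ 0 := by positivity
  simp only [vertex, act, basePoint]
  rw [div_eq_iff h]
  linear_combination (-(1 - (((u⁻¹ i : Fin 3) : ℕ) : ℝ))) * sqrt_two_mul_self

theorem sum_eq_zero_of_mem {x : E 3} (hx : x ∈ permutohedron 3) : x 0 + x 1 + x 2 = 0 := by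
  have hconv : Convex ℝ {x : E 3 | x 0 + x 1 + x 2 = 0} := by
    intro x hx y hy a b _ _ _
    simp only [mem_ofPred_eq, PiLp.add_apply, PiLp.smul_apply, smul_eq_mul] at *
    linear_combination a * hx + b * hy
  refine convexHull_min ?_ hconv hx
  rintro _ ⟨u, rfl⟩
  have h := Equiv.sum_comp u⁻¹ (fun k : Fin 3 => √2 * (1 - ((k : ℕ) : ℝ)))
  simp only [Fin.sum_univ_three] at h
  simp only [mem_ofPred_eq, vertex_apply]
  rw [h]
  simp
  ring

theorem abs_le_of_mem {x : E 3} (hx : x ∈ permutohedron 3) (i : Fin 3) : |x i| ≤ √2 := by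
  have hconv : Convex ℝ {x : E 3 | |x i| ≤ √2} := by
    intro x hx y hy a b ha hb hab
    simp only [mem_ofPred_eq, PiLp.add_apply, PiLp.smul_apply, smul_eq_mul, abs_le] at *
    have hb' : b = 1 - a := by linarith
    subst hb'
    constructor <;> nlinarith
  refine convexHull_min ?_ hconv hx
  rintro _ ⟨u, rfl⟩
  simp only [mem_ofPred_eq, vertex_apply]
  have h0 : (0 : ℝ) ≤ √2 := by positivity
  generalize u⁻¹ i = k
  rw [abs_mul, abs_of_nonneg h0]
  fin_cases k
  all_goals simp
  all_goals norm_num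

theorem vertex_mem (u : Equiv.Perm (Fin 3)) : vertex u ∈ permutohedron 3 :=
  subset_convexHull _ _ ⟨u, rfl⟩

theorem add_add_eq_of_ne {l i j : Fin 3} (hli : l ≠ i) (hlj : l ≠ j) (hij : i ≠ j) (x : E 3) :
    x l + x i + x j = x 0 + x 1 + x 2 := by
  fin_cases l <;> fin_cases i <;> fin_cases j <;> simp at * <;> ring

theorem ext_of_ne {l i j : Fin 3} (hli : l ≠ i) (hlj : l ≠ j) (hij : i ≠ j) {x y : E 3}
    (hl : x l = y l) (hi : x i = y i) (hj : x j = y j) : x = y := by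
  ext m
  have : m = l ∨ m = i ∨ m = j := by omega
  rcases this with rfl | rfl | rfl <;> assumption

theorem add_add_eq_zero_of_mem {l i j : Fin 3} (hli : l ≠ i) (hlj : l ≠ j) (hij : i ≠ j) {x : E 3}
    (hx : x ∈ permutohedron 3) : x l + x i + x j = 0 :=
  (add_add_eq_of_ne hli hlj hij x).trans (sum_eq_zero_of_mem hx)

/-- For points of the hexagon: being a vertex, in terms of coordinates. -/
def IsCorner (x : E 3) : Prop := ∃ i j, x i = √2 ∧ x j = -√2

theorem isCorner_vertex (u : Equiv.Perm (Fin 3)) : IsCorner (vertex u) :=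
  ⟨u 0, u 2, by simp [vertex_apply], by simp [vertex_apply]; ring⟩

theorem IsCorner.exists_eq_vertex {x : E 3} (h : IsCorner x) (hx : x ∈ permutohedron 3) :
    ∃ u, x = vertex u := by
  obtain ⟨i, j, hi, hj⟩ := h
  have h2 : (0 : ℝ) < √2 := by positivity
  have hij : i ≠ j := by
    rintro rfl
    linarith
  have key : ∀ i j : Fin 3, i ≠ j → ∃ u : Equiv.Perm (Fin 3), u 0 = i ∧ u 2 = j := by decide
  obtain ⟨u, rfl, rfl⟩ := key i j hij
  have h01 : u 0 ≠ u 1 := by simp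
  have h12 : u 1 ≠ u 2 := by simp
  have hs := add_add_eq_zero_of_mem h01.symm h12 hij hx
  refine ⟨u, ext_of_ne h01.symm h12 hij ?_ ?_ ?_⟩ <;> (simp [vertex_apply]; linarith)

/-- On the edges `x l = ± √2`, the vertices are the points where the two other coordinates differ
by `± √2`. -/
theorem isCorner_iff {l i j : Fin 3} (hli : l ≠ i) (hlj : l ≠ j) (hij : i ≠ j) {x : E 3}
    (hx : x ∈ permutohedron 3) (hl : |x l| = √2) : IsCorner x ↔ |x i - x j| = √2 := by
  have hs := add_add_eq_zero_of_mem hli hlj hij hx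
  have h2 : (0 : ℝ) < √2 := by positivity
  constructor
  · rintro ⟨a, b, ha, hb⟩
    have hab : a ≠ b := by rintro rfl; linarith
    have ha' : a = l ∨ a = i ∨ a = j := by omega
    have hb' : b = l ∨ b = i ∨ b = j := by omega
    rw [abs_eq h2.le] at hl ⊢
    rcases ha' with rfl | rfl | rfl <;> rcases hb' with rfl | rfl | rfl <;>
      first
      | exact absurd rfl hab
      | (rcases hl with hl | hl <;> first
          | (left; linarith)
          | (right; linarith))
  · intro h
    rw [abs_eq h2.le] at hl h
    rcases hl with hl | hl <;> rcases h with h | h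
    · exact ⟨l, j, hl, by linarith⟩
    · exact ⟨l, i, hl, by linarith⟩
    · exact ⟨i, l, by linarith, hl⟩
    · exact ⟨j, l, by linarith, hl⟩

theorem isCorner_of_abs_eq {l m : Fin 3} (hlm : l ≠ m) {x : E 3} (hx : x ∈ permutohedron 3)
    (hl : |x l| = √2) (hm : |x m| = √2) : IsCorner x := by
  have h2 : (0 : ℝ) < √2 := by positivity
  have key : ∀ l m : Fin 3, l ≠ m → ∃ k, l ≠ k ∧ m ≠ k := by decide
  obtain ⟨k, hlk, hmk⟩ := key l m hlm
  have hs := add_add_eq_zero_of_mem hlm hlk hmk hx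
  have hk := abs_le.1 (abs_le_of_mem hx k)
  rw [abs_eq h2.le] at hl hm
  rcases hl with hl | hl <;> rcases hm with hm | hm
  · linarith
  · exact ⟨l, m, hl, hm⟩
  · exact ⟨m, l, hm, hl⟩
  · linarith

/-! ### The fibres of the quotient map -/

/-- The points `p` and `q` lie on edges whose block is `{i, j}` and which are identified, and they
correspond to each other. Here `l` is the letter outside the block. -/
def EdgeRel (l i j : Fin 3) (p q : Cells 3) : Prop :=
  |(p.1 : E 3) l| = √2 ∧ |(q.1 : E 3) l| = √2 ∧
    (p.1 : E 3) i - (p.1 : E 3) j = (q.1 : E 3) i - (q.1 : E 3) j ∧ (p.2 i < p.2 j ↔ q.2 i < q.2 j)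

/-- The identifications in `Ω₃` in coordinates: two points are identified iff they are equal, or
both are vertices, or they correspond to each other on identified edges. -/
def Rel (p q : Cells 3) : Prop :=
  p = q ∨ (IsCorner p.1 ∧ IsCorner q.1) ∨ ∃ l i j, l ≠ i ∧ l ≠ j ∧ i < j ∧ EdgeRel l i j p q

theorem EdgeRel.symm {l i j : Fin 3} {p q : Cells 3} (h : EdgeRel l i j p q) : EdgeRel l i j q p :=
  ⟨h.2.1, h.1, h.2.2.1.symm, h.2.2.2.symm⟩

theorem EdgeRel.isCorner {l i j : Fin 3} (hli : l ≠ i) (hlj : l ≠ j) (hij : i < j) {p q : Cells 3}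
    (h : EdgeRel l i j p q) (hp : IsCorner p.1) : IsCorner q.1 := by
  rw [isCorner_iff hli hlj hij.ne p.1.2 h.1] at hp
  rwa [isCorner_iff hli hlj hij.ne q.1.2 h.2.1, ← h.2.2.1]

theorem Rel.symm {p q : Cells 3} : Rel p q → Rel q p := by
  rintro (rfl | ⟨h, h'⟩ | ⟨l, i, j, hli, hlj, hij, h⟩)
  · exact Or.inl rfl
  · exact Or.inr (Or.inl ⟨h', h⟩)
  · exact Or.inr (Or.inr ⟨l, i, j, hli, hlj, hij, h.symm⟩)

theorem Rel.trans {p q r : Cells 3} : Rel p q → Rel q r → Rel p r := by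
  rintro (rfl | ⟨h, h'⟩ | ⟨l, i, j, hli, hlj, hij, h⟩)
  · exact id
  · rintro (rfl | ⟨k, k'⟩ | ⟨l, i, j, hli, hlj, hij, k⟩)
    · exact Or.inr (Or.inl ⟨h, h'⟩)
    · exact Or.inr (Or.inl ⟨h, k'⟩)
    · exact Or.inr (Or.inl ⟨h, k.isCorner hli hlj hij h'⟩)
  · rintro (rfl | ⟨k, k'⟩ | ⟨l', i', j', hli', hlj', hij', k⟩)
    · exact Or.inr (Or.inr ⟨l, i, j, hli, hlj, hij, h⟩)
    · exact Or.inr (Or.inl ⟨h.symm.isCorner hli hlj hij k, k'⟩)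
    · by_cases hl : l = l'
      · subst hl
        obtain ⟨rfl, rfl⟩ : i = i' ∧ j = j' := by omega
        exact Or.inr (Or.inr ⟨l, i, j, hli, hlj, hij, h.1, k.2.1, h.2.2.1.trans k.2.2.1,
          h.2.2.2.trans k.2.2.2⟩)
      · have hq := isCorner_of_abs_eq hl q.1.2 h.2.1 k.1
        exact Or.inr (Or.inl ⟨h.symm.isCorner hli hlj hij hq, k.isCorner hli' hlj' hij' hq⟩)

/-- The coordinates at the letters which are fixed by `u W_X u⁻¹` are constant on the face
`F(u, X)`. -/
theorem apply_eq_of_mem_face {u : Equiv.Perm (Fin 3)} {X : Set (Fin (3 - 1))} {l : Fin 3}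
    (h : ∀ k ∈ X, simple k (u⁻¹ l) = u⁻¹ l) {x : E 3} (hx : x ∈ face u X) :
    x l = vertex u l := by
  have hconv : Convex ℝ {x : E 3 | x l = vertex u l} := by
    intro x hx y hy a b _ _ hab
    simp only [mem_ofPred_eq, PiLp.add_apply, PiLp.smul_apply, smul_eq_mul] at *
    rw [hx, hy, ← add_mul, hab, one_mul]
  refine convexHull_min ?_ hconv hx
  rintro _ ⟨w, hw, rfl⟩
  have hle : parabolic X ≤ MulAction.stabilizer (Equiv.Perm (Fin 3)) (u⁻¹ l) := by
    rw [parabolic, Subgroup.closure_le]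
    rintro _ ⟨k, hk, rfl⟩
    exact h k hk
  have hw' : w⁻¹ (u⁻¹ l) = u⁻¹ l := (Subgroup.inv_mem _ (hle hw) :)
  simp only [mem_ofPred_eq, vertex_apply, mul_inv_rev, Equiv.Perm.mul_apply, hw']

/-- A version of the relation `blocks u X` in which membership in `X` is Boolean: `x k` says that
`s_k` belongs to `X`. -/
def boolBlocks (u : Equiv.Perm (Fin 3)) (x : Fin (3 - 1) → Bool) (a b : Fin 3) : Bool :=
  (x 0 || (u⁻¹ a ≤ 0 ↔ u⁻¹ b ≤ 0)) && (x 1 || (u⁻¹ a ≤ 1 ↔ u⁻¹ b ≤ 1))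

set_option synthInstance.maxHeartbeats 400000 in
set_option synthInstance.maxSize 2000 in
/-- The possible shapes of a glueing of faces: the identity of the whole hexagon, two vertices, or
two edges with the same block `{i, j}`. -/
theorem glue_cases (u v : Equiv.Perm (Fin 3)) {X Y : Set (Fin (3 - 1))} (hu : IsMinimal u X)
    (hv : IsMinimal v Y) (h : blocks u X = blocks v Y) :
    (u = 1 ∧ v = 1 ∧ ∀ a b, blocks u X a b) ∨ (X = ∅ ∧ Y = ∅) ∨
    ∃ l i j, l ≠ i ∧ l ≠ j ∧ i < j ∧ blocks u X i j ∧
      (u⁻¹ l = 0 ∨ u⁻¹ l = 2) ∧ (v⁻¹ l = 0 ∨ v⁻¹ l = 2) ∧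
      (∀ k ∈ X, simple k (u⁻¹ l) = u⁻¹ l) ∧ (∀ k ∈ Y, simple k (v⁻¹ l) = v⁻¹ l) ∧
      (((u⁻¹ j : Fin 3) : ℕ) = (u⁻¹ i : Fin 3) + 1) ∧
      (((v⁻¹ j : Fin 3) : ℕ) = (v⁻¹ i : Fin 3) + 1) := by
  have key : ∀ (x y : Fin (3 - 1) → Bool) (u v : Equiv.Perm (Fin 3)),
      (∀ k : Fin (3 - 1), x k → u (lo k) < u (hi k)) →
      (∀ k : Fin (3 - 1), y k → v (lo k) < v (hi k)) →
      (∀ a b, boolBlocks u x a b = boolBlocks v y a b) →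
      (u = 1 ∧ v = 1 ∧ ∀ a b, boolBlocks u x a b) ∨ ((∀ k, x k = false) ∧ ∀ k, y k = false) ∨
      ∃ l i j, l ≠ i ∧ l ≠ j ∧ i < j ∧ boolBlocks u x i j ∧
        (u⁻¹ l = 0 ∨ u⁻¹ l = 2) ∧ (v⁻¹ l = 0 ∨ v⁻¹ l = 2) ∧
        (∀ k : Fin (3 - 1), x k → simple k (u⁻¹ l) = u⁻¹ l) ∧
        (∀ k : Fin (3 - 1), y k → simple k (v⁻¹ l) = v⁻¹ l) ∧
        (((u⁻¹ j : Fin 3) : ℕ) = (u⁻¹ i : Fin 3) + 1) ∧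
        (((v⁻¹ j : Fin 3) : ℕ) = (v⁻¹ i : Fin 3) + 1) := by
    decide +kernel
  classical
  have hbl : ∀ (u : Equiv.Perm (Fin 3)) (X : Set (Fin (3 - 1))) (a b : Fin 3),
      blocks u X a b ↔ boolBlocks u (fun k => decide (k ∈ X)) a b = true := by
    intro u X a b
    change (∀ k : Fin 2, k ∉ X → _) ↔ _
    rw [Fin.forall_fin_two]
    simp [boolBlocks, lo, ← or_iff_not_imp_left]
  have := key (fun k => decide (k ∈ X)) (fun k => decide (k ∈ Y)) u v
    (fun k hk => hu k (of_decide_eq_true hk)) (fun k hk => hv k (of_decide_eq_true hk))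
    (fun a b => Bool.eq_iff_iff.2 (by rw [← hbl, ← hbl, h]))
  simp only [← hbl, decide_eq_true_eq, decide_eq_false_iff_not] at this
  rcases this with h | ⟨h, h'⟩ | h
  · exact Or.inl h
  · exact Or.inr (Or.inl ⟨eq_empty_of_forall_notMem h, eq_empty_of_forall_notMem h'⟩)
  · exact Or.inr (Or.inr h)

theorem Glue.rel {p q : Cells 3} (h : Glue p q) : Rel p q := by
  obtain ⟨u, v, X, Y, hu, hv, hb, hw, hp, hq⟩ := h
  have hq' : ∀ m, (q.1 : E 3) m = (p.1 : E 3) m + (vertex v m - vertex u m) := fun m => by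
    rw [hq]; rfl
  rcases glue_cases u v hu hv hb with ⟨rfl, rfl, hall⟩ | ⟨rfl, rfl⟩ | ⟨l, i, j, hli, hlj, hij, hbl,
    hul, hvl, hX, hY, hu', hv'⟩
  · left
    have key : ∀ w w' : Equiv.Perm (Fin 3), (∀ i j, w i < w j ↔ w' i < w' j) → w = w' := by decide
    refine Prod.ext (Subtype.ext ?_) (key _ _ fun i j => hw i j (hall i j))
    simp [hq]
  · right; left
    have hp' : (p.1 : E 3) = vertex u := by
      ext m
      exact apply_eq_of_mem_face (by simp) hp
    have hq'' : (q.1 : E 3) = vertex v := by rw [hq, hp']; abel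
    rw [hp', hq'']
    exact ⟨isCorner_vertex u, isCorner_vertex v⟩
  · right; right
    have h2 : (0 : ℝ) ≤ √2 := by positivity
    have habs : ∀ u : Equiv.Perm (Fin 3), (u⁻¹ l = 0 ∨ u⁻¹ l = 2) → |vertex u l| = √2 := by
      rintro u (h | h) <;> rw [vertex_apply, h, abs_mul, abs_of_nonneg h2] <;> norm_num
    have hpl := apply_eq_of_mem_face hX hp
    refine ⟨l, i, j, hli, hlj, hij, ?_, ?_, ?_, hw i j hbl⟩
    · rw [hpl, habs u hul]
    · rw [hq', hpl, add_sub_cancel, habs v hvl]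
    · rw [hq', hq', vertex_apply, vertex_apply, vertex_apply, vertex_apply, hu', hv']
      push_cast
      ring

/-- The relation `Rel` contains the equivalence relation defining `Ω₃`. -/
theorem toOmega_eq_imp {p q : Cells 3} (h : toOmega p = toOmega q) : Rel p q := by
  have h' := Quot.eqvGen_exact h
  clear h
  induction h' with
  | rel _ _ h => exact h.rel
  | refl => exact Or.inl rfl
  | symm _ _ _ ih => exact ih.symm
  | trans _ _ _ _ _ ih ih' => exact ih.trans ih'

/-- An edge with block `{i, j}` is a face `F(u, X)` with `u` minimal. -/
theorem exists_mem_face {l i j : Fin 3} (hli : l ≠ i) (hlj : l ≠ j) (hij : i < j) {x : E 3}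
    (hx : x ∈ permutohedron 3) (hl : |x l| = √2) :
    ∃ (u : Equiv.Perm (Fin 3)) (X : Set (Fin (3 - 1))), IsMinimal u X ∧ x ∈ face u X ∧
      (∀ a b, blocks u X a b ↔ (a = l ↔ b = l)) ∧ vertex u i - vertex u j = √2 ∧
      x l = vertex u l := by
  have h2 : (0 : ℝ) < √2 := by positivity
  have hs := add_add_eq_zero_of_mem hli hlj hij.ne hx
  have hxi := abs_le.1 (abs_le_of_mem hx i)
  have hxj := abs_le.1 (abs_le_of_mem hx j)
  have hseg : ∀ (u : Equiv.Perm (Fin 3)) (k : Fin (3 - 1)), x l = vertex u l →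
      vertex (u * simple k) l = vertex u l →
      vertex u i - vertex u j = √2 → vertex (u * simple k) i - vertex (u * simple k) j = -√2 →
      x ∈ face u {k} := by
    intro u k hul hkl huij hkij
    have hu := add_add_eq_zero_of_mem hli hlj hij.ne (vertex_mem u)
    have hk := add_add_eq_zero_of_mem hli hlj hij.ne (vertex_mem (u * simple k))
    have h1 : vertex u ∈ face u {k} :=
      subset_convexHull _ _ ⟨1, Subgroup.one_mem _, by simp⟩
    have h1' : vertex (u * simple k) ∈ face u {k} :=
      subset_convexHull _ _ ⟨simple k, Subgroup.subset_closure ⟨k, rfl, rfl⟩, rfl⟩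
    set c : ℝ := (√2 - (x i - x j)) / (2 * √2) with hc
    have hc' : c * (2 * √2) = √2 - (x i - x j) := div_mul_cancel₀ _ (by positivity)
    have hc0 : 0 ≤ c := by
      refine div_nonneg ?_ (by positivity)
      rcases (abs_eq h2.le).1 hl with hl | hl <;> linarith
    have hc1 : 0 ≤ 1 - c := by
      by_contra h
      rcases (abs_eq h2.le).1 hl with hl | hl <;> nlinarith
    have hmem := (convex_convexHull ℝ _) h1 h1' hc1 hc0 (by ring)
    refine (?_ : x = _) ▸ hmem
    refine ext_of_ne hli hlj hij.ne ?_ ?_ ?_ <;>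
      simp only [PiLp.add_apply, PiLp.smul_apply, smul_eq_mul]
    · rw [hul, hkl]; ring
    · have : vertex u i = (√2 - x l) / 2 := by linarith
      have : vertex (u * simple k) i = (-√2 - x l) / 2 := by linarith
      simp only [*]
      linear_combination hs / 2 + hc' / 2 - hul / 2
    · have : vertex u j = (-√2 - x l) / 2 := by linarith
      have : vertex (u * simple k) j = (√2 - x l) / 2 := by linarith
      simp only [*]
      linear_combination hs / 2 - hc' / 2 - hul / 2
  rcases (abs_eq h2.le).1 hl with hl | hl
  · have key : ∀ l i j : Fin 3, l ≠ i → l ≠ j → i < j → ∃ u : Equiv.Perm (Fin 3),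
        u (lo 1) < u (hi 1) ∧ (u⁻¹ l = 0 ∧ u⁻¹ i = 1 ∧ u⁻¹ j = 2) ∧
        ((u * simple (n := 3) 1)⁻¹ l = 0 ∧ (u * simple (n := 3) 1)⁻¹ i = 2 ∧
          (u * simple (n := 3) 1)⁻¹ j = 1) ∧
        ∀ a b, (u⁻¹ a ≤ 0 ↔ u⁻¹ b ≤ 0) ↔ (a = l ↔ b = l) := by decide +kernel
    obtain ⟨u, h1, ⟨hul, hui, huj⟩, ⟨hul', hui', huj'⟩, hb⟩ := key l i j hli hlj hij
    refine ⟨u, {1}, ?_, hseg u 1 ?_ ?_ ?_ ?_, ?_, ?_, ?_⟩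
    · rintro k rfl; exact h1
    · rw [hl, vertex_apply, hul]; simp
    · rw [vertex_apply, vertex_apply, hul, hul']
    · rw [vertex_apply, vertex_apply, hui, huj]; simp; ring
    · rw [vertex_apply, vertex_apply, hui', huj']; simp; ring
    · intro a b
      rw [← hb]
      change (∀ k : Fin 2, k ∉ ({1} : Set (Fin 2)) → _) ↔ _
      rw [Fin.forall_fin_two]
      simp [lo]
    · rw [vertex_apply, vertex_apply, hui, huj]; simp; ring
    · rw [hl, vertex_apply, hul]; simp
  · have key : ∀ l i j : Fin 3, l ≠ i → l ≠ j → i < j → ∃ u : Equiv.Perm (Fin 3),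
        u (lo 0) < u (hi 0) ∧ (u⁻¹ l = 2 ∧ u⁻¹ i = 0 ∧ u⁻¹ j = 1) ∧
        ((u * simple (n := 3) 0)⁻¹ l = 2 ∧ (u * simple (n := 3) 0)⁻¹ i = 1 ∧
          (u * simple (n := 3) 0)⁻¹ j = 0) ∧
        ∀ a b, (u⁻¹ a ≤ 1 ↔ u⁻¹ b ≤ 1) ↔ (a = l ↔ b = l) := by decide +kernel
    obtain ⟨u, h1, ⟨hul, hui, huj⟩, ⟨hul', hui', huj'⟩, hb⟩ := key l i j hli hlj hij
    refine ⟨u, {0}, ?_, hseg u 0 ?_ ?_ ?_ ?_, ?_, ?_, ?_⟩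
    · rintro k rfl; exact h1
    · rw [hl, vertex_apply, hul]; simp; ring
    · rw [vertex_apply, vertex_apply, hul, hul']
    · rw [vertex_apply, vertex_apply, hui, huj]; simp
    · rw [vertex_apply, vertex_apply, hui', huj']; simp
    · intro a b
      rw [← hb]
      change (∀ k : Fin 2, k ∉ ({0} : Set (Fin 2)) → _) ↔ _
      rw [Fin.forall_fin_two]
      simp [lo]
    · rw [vertex_apply, vertex_apply, hui, huj]; simp
    · rw [hl, vertex_apply, hul]; simp; ring

theorem EdgeRel.toOmega_eq {l i j : Fin 3} (hli : l ≠ i) (hlj : l ≠ j) (hij : i < j)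
    {p q : Cells 3} (h : EdgeRel l i j p q) : toOmega p = toOmega q := by
  obtain ⟨hp, hq, hd, hw⟩ := h
  obtain ⟨u, X, hu, hpu, hbu, huij, hul⟩ := exists_mem_face hli hlj hij p.1.2 hp
  obtain ⟨v, Y, hv, hqv, hbv, hvij, hvl⟩ := exists_mem_face hli hlj hij q.1.2 hq
  have hw' : p.2 j < p.2 i ↔ q.2 j < q.2 i := by
    rw [← not_iff_not, not_lt, not_lt, le_iff_lt_or_eq, le_iff_lt_or_eq, hw]
    simp [hij.ne]
  refine Quot.sound ⟨u, v, X, Y, hu, hv, Setoid.ext fun a b => (hbu a b).trans (hbv a b).symm,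
    fun a b hab => ?_, hpu, ?_⟩
  · rw [hbu] at hab
    have ha : a = l ∨ a = i ∨ a = j := by omega
    have hb : b = l ∨ b = i ∨ b = j := by omega
    rcases ha with rfl | rfl | rfl <;> rcases hb with rfl | rfl | rfl <;> simp_all
  · have hps := add_add_eq_zero_of_mem hli hlj hij.ne p.1.2
    have hqs := add_add_eq_zero_of_mem hli hlj hij.ne q.1.2
    have hus := add_add_eq_zero_of_mem hli hlj hij.ne (vertex_mem u)
    have hvs := add_add_eq_zero_of_mem hli hlj hij.ne (vertex_mem v)
    refine ext_of_ne hli hlj hij.ne ?_ ?_ ?_ <;> simp only [PiLp.add_apply, PiLp.sub_apply] <;>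
      linarith

theorem mem_face_empty (u : Equiv.Perm (Fin 3)) : vertex u ∈ face u ∅ :=
  subset_convexHull _ _ ⟨1, Subgroup.one_mem _, by simp⟩

theorem toOmega_vertex_eq (u v w w' : Equiv.Perm (Fin 3)) :
    toOmega (⟨vertex u, vertex_mem u⟩, w) = toOmega (⟨vertex v, vertex_mem v⟩, w') := by
  have hb : ∀ (u : Equiv.Perm (Fin 3)) (a b : Fin 3), blocks u ∅ a b ↔ a = b := by
    intro u a b
    refine ⟨fun h => ?_, fun h => h ▸ (blocks u ∅).refl a⟩
    have h0 : u⁻¹ a ≤ 0 ↔ u⁻¹ b ≤ 0 := h 0 (by simp)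
    have h1 : u⁻¹ a ≤ 1 ↔ u⁻¹ b ≤ 1 := h 1 (by simp)
    exact u⁻¹.injective (by omega)
  refine Quot.sound ⟨u, v, ∅, ∅, by simp [IsMinimal], by simp [IsMinimal],
    Setoid.ext fun a b => (hb u a b).trans (hb v a b).symm, fun a b hab => ?_, mem_face_empty u, ?_⟩
  · obtain rfl := (hb u a b).1 hab
    simp
  · simp

/-- The vertex of `Ω₃`. -/
def theVertex : Omega 3 := toOmega (⟨vertex 1, vertex_mem 1⟩, 1)

theorem isVertex_iff (p : Omega 3) : IsVertex p ↔ p = theVertex := by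
  constructor
  · rintro ⟨⟨⟨x, hx⟩, w⟩, rfl, u, rfl : x = vertex u⟩
    exact toOmega_vertex_eq u 1 w 1
  · rintro rfl
    exact ⟨_, rfl, 1, rfl⟩

theorem toOmega_eq_theVertex {p : Cells 3} (h : toOmega p = theVertex) :
    ∃ u, (p.1 : E 3) = vertex u := by
  rcases toOmega_eq_imp h with h | ⟨h, _⟩ | ⟨l, i, j, hli, hlj, hij, h⟩
  · exact ⟨1, by rw [h]⟩
  · exact h.exists_eq_vertex p.1.2
  · exact (h.symm.isCorner hli hlj hij (isCorner_vertex 1)).exists_eq_vertex p.1.2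

/-! ### Estimates for quotient metrics -/

section Strings

variable {A Q Y : Type*} [PseudoEMetricSpace Y]

theorem stringEDist_le (π : A → Q) (c : A → A → ℝ≥0∞) (a b : A) :
    stringEDist π c (π a) (π b) ≤ c a b :=
  sInf_le (IsString.single a b)

/-- A function on the quotient which is `1`-Lipschitz upstairs is `1`-Lipschitz. All lower bounds of
distances below come from such functions. -/
theorem edist_le_stringEDist {π : A → Q} {c : A → A → ℝ≥0∞} {f : Q → Y}
    (h : ∀ a b, edist (f (π a)) (f (π b)) ≤ c a b) (x y : Q) :
    edist (f x) (f y) ≤ stringEDist π c x y := by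
  refine le_sInf fun L hL => ?_
  induction hL with
  | single a b => exact h a b
  | snoc a b _ ih => exact (edist_triangle _ _ _).trans (add_le_add ih (h a b))

end Strings

theorem edist_toOmega_le {w : Equiv.Perm (Fin 3)} (x y : permutohedron 3) :
    edist (toOmega (x, w)) (toOmega (y, w)) ≤ ENNReal.ofReal (dist (x : E 3) y) := by
  refine (stringEDist_le toOmega cellEDist (x, w) (y, w)).trans ?_
  simp [cellEDist, ← edist_dist, Subtype.edist_eq]

theorem ofReal_abs_sub_le_edist {F : Cells 3 → ℝ} (hF : ∀ p q, Rel p q → F p = F q)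
    (hL : ∀ p q : Cells 3, p.2 = q.2 → |F p - F q| ≤ dist (p.1 : E 3) q.1) (p q : Cells 3) :
    ENNReal.ofReal |F p - F q| ≤ edist (toOmega p) (toOmega q) := by
  let f : Omega 3 → ℝ := Quot.lift F fun p q h => hF p q h.rel
  have := edist_le_stringEDist (π := toOmega) (c := cellEDist (n := 3)) (f := f) (fun a b => ?_)
    (toOmega p) (toOmega q)
  · rwa [edist_dist, Real.dist_eq] at this
  · by_cases h : a.2 = b.2
    · rw [cellEDist, if_pos h, Subtype.edist_eq, edist_dist, edist_dist]
      exact ENNReal.ofReal_le_ofReal (hL a b h)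
    · simp [cellEDist, h]

theorem dist_sq_eq (x y : E 3) :
    dist x y ^ 2 = (x 0 - y 0) ^ 2 + (x 1 - y 1) ^ 2 + (x 2 - y 2) ^ 2 := by
  rw [EuclideanSpace.dist_sq_eq, Fin.sum_univ_three]
  simp [Real.dist_eq, sq_abs]

/-- In the plane of the hexagon, `√(3/2)` times a coordinate is a `1`-Lipschitz function. -/
theorem sqrt_mul_abs_le_dist {x y : E 3} (hx : x ∈ permutohedron 3) (hy : y ∈ permutohedron 3)
    (i : Fin 3) : √(3 / 2) * |x i - y i| ≤ dist x y := by
  have hx := sum_eq_zero_of_mem hx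
  have hy := sum_eq_zero_of_mem hy
  refine le_of_sq_le_sq ?_ dist_nonneg
  rw [mul_pow, Real.sq_sqrt (by norm_num), sq_abs, dist_sq_eq]
  have h2 : x 2 - y 2 = -(x 0 - y 0) - (x 1 - y 1) := by linarith
  obtain rfl | rfl | rfl : i = 0 ∨ i = 1 ∨ i = 2 := by omega
  · rw [h2]
    nlinarith [sq_nonneg ((x 0 - y 0) + 2 * (x 1 - y 1))]
  · rw [h2]
    nlinarith [sq_nonneg (2 * (x 0 - y 0) + (x 1 - y 1))]
  · rw [h2]
    nlinarith [sq_nonneg ((x 0 - y 0) - (x 1 - y 1))]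

/-! ### The corner of the hexagon at the vertex `213` -/

/-- The vertex of the hexagon whose word is `213`. -/
def cornerVertex : E 3 := vertex (Equiv.swap 0 1)

/-- The unit vector at the point `s` of the arc of directions at the corner `213`, where the arc is
parametrized by the angle with the edge along which `1` and `2` are exchanged. -/
def arcDir (s : ℝ) : E 3 :=
  Real.cos s • !₂[√2 / 2, -(√2 / 2), 0] + Real.sin s • !₂[-(√6 / 6), -(√6 / 6), √6 / 3]

theorem cornerVertex_zero : cornerVertex 0 = 0 := by
  rw [cornerVertex, vertex_apply, show (Equiv.swap (0 : Fin 3) 1)⁻¹ 0 = 1 by decide]; simp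

theorem cornerVertex_one : cornerVertex 1 = √2 := by
  rw [cornerVertex, vertex_apply, show (Equiv.swap (0 : Fin 3) 1)⁻¹ 1 = 0 by decide]; simp

theorem cornerVertex_two : cornerVertex 2 = -√2 := by
  rw [cornerVertex, vertex_apply, show (Equiv.swap (0 : Fin 3) 1)⁻¹ 2 = 2 by decide]; simp; ring

theorem cornerVertex_mem : cornerVertex ∈ permutohedron 3 := vertex_mem _

theorem arcDir_apply_zero (s : ℝ) : arcDir s 0 = Real.cos s * (√2 / 2) - Real.sin s * (√6 / 6) := by
  simp [arcDir]; ring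

theorem arcDir_apply_one (s : ℝ) :
    arcDir s 1 = -(Real.cos s * (√2 / 2)) - Real.sin s * (√6 / 6) := by
  simp [arcDir]; ring

theorem arcDir_apply_two (s : ℝ) : arcDir s 2 = Real.sin s * (√6 / 3) := by
  simp [arcDir]

theorem sqrt_six_mul_self : √6 * √6 = 6 := Real.mul_self_sqrt (by norm_num)

theorem sqrt_three_mul_self : √3 * √3 = 3 := Real.mul_self_sqrt (by norm_num)

theorem sqrt_three_mul_sqrt_two : √3 * √2 = √6 := by
  rw [← Real.sqrt_mul (by norm_num)]; norm_num

theorem sqrt_three_mul_sqrt_six : √3 * √6 = 3 * √2 := by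
  rw [← sqrt_three_mul_sqrt_two, ← mul_assoc, sqrt_three_mul_self]

theorem cos_two_pi_div_three : Real.cos (2 * Real.pi / 3) = -(1 / 2) := by
  rw [show 2 * Real.pi / 3 = Real.pi - Real.pi / 3 by ring, Real.cos_pi_sub, Real.cos_pi_div_three]

theorem sin_two_pi_div_three : Real.sin (2 * Real.pi / 3) = √3 / 2 := by
  rw [show 2 * Real.pi / 3 = Real.pi - Real.pi / 3 by ring, Real.sin_pi_sub, Real.sin_pi_div_three]

theorem arcDir_zero_apply_zero : arcDir 0 0 = √2 / 2 := by simp [arcDir_apply_zero]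

theorem arcDir_zero_apply_one : arcDir 0 1 = -(√2 / 2) := by simp [arcDir_apply_one]

theorem arcDir_zero_apply_two : arcDir 0 2 = 0 := by simp [arcDir_apply_two]

theorem arcDir_end_apply_zero : arcDir (2 * Real.pi / 3) 0 = -(√2 / 2) := by
  rw [arcDir_apply_zero, cos_two_pi_div_three, sin_two_pi_div_three]
  linear_combination -sqrt_three_mul_sqrt_six / 12

theorem arcDir_end_apply_one : arcDir (2 * Real.pi / 3) 1 = 0 := by
  rw [arcDir_apply_one, cos_two_pi_div_three, sin_two_pi_div_three]
  linear_combination -sqrt_three_mul_sqrt_six / 12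

theorem arcDir_end_apply_two : arcDir (2 * Real.pi / 3) 2 = √2 / 2 := by
  rw [arcDir_apply_two, sin_two_pi_div_three]
  linear_combination sqrt_three_mul_sqrt_six / 6

theorem inner_eq (x y : E 3) : inner ℝ x y = x 0 * y 0 + x 1 * y 1 + x 2 * y 2 := by
  simp [PiLp.inner_apply, Fin.sum_univ_three]; ring

theorem inner_arcDir (s t : ℝ) : inner ℝ (arcDir s) (arcDir t) = Real.cos (s - t) := by
  rw [inner_eq, Real.cos_sub]
  simp only [arcDir_apply_zero, arcDir_apply_one, arcDir_apply_two]
  linear_combination (Real.cos s * Real.cos t / 2) * sqrt_two_mul_self +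
    (Real.sin s * Real.sin t / 6) * sqrt_six_mul_self

theorem norm_arcDir (s : ℝ) : ‖arcDir s‖ = 1 := by
  have h := inner_arcDir s s
  rw [real_inner_self_eq_norm_sq, sub_self, Real.cos_zero] at h
  exact (pow_eq_one_iff_of_nonneg (norm_nonneg _) two_ne_zero).1 h

/-- The hexagon contains the triangle spanned by a vertex and its two neighbours. -/
theorem cornerVertex_add_mem {a b : ℝ} (ha : 0 ≤ a) (hb : 0 ≤ b) (hab : a + b ≤ 2) :
    cornerVertex + a • arcDir 0 + b • arcDir (2 * Real.pi / 3) ∈ permutohedron 3 := by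
  have hconv : Convex ℝ (permutohedron 3) := convex_convexHull ℝ _
  have h1 := vertex_mem 1
  have h2 := vertex_mem (Equiv.swap 0 1 * Equiv.swap 1 2)
  have hsum := hconv.sum_mem (t := Finset.univ) (w := ![1 - a / 2 - b / 2, a / 2, b / 2])
    (z := ![cornerVertex, vertex 1, vertex (Equiv.swap 0 1 * Equiv.swap 1 2)])
    (by intro i _; fin_cases i <;> simp <;> linarith) (by simp [Fin.sum_univ_three]; ring)
    (by intro i _; fin_cases i; exacts [cornerVertex_mem, h1, h2])
  have e10 : vertex (1 : Equiv.Perm (Fin 3)) 0 = √2 := by simp [vertex_apply]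
  have e11 : vertex (1 : Equiv.Perm (Fin 3)) 1 = 0 := by simp [vertex_apply]
  have e12 : vertex (1 : Equiv.Perm (Fin 3)) 2 = -√2 := by simp [vertex_apply]; ring
  have e20 : vertex (Equiv.swap (0 : Fin 3) 1 * Equiv.swap 1 2) 0 = -√2 := by
    rw [vertex_apply,
      show (Equiv.swap (0 : Fin 3) 1 * Equiv.swap 1 2 : Equiv.Perm (Fin 3))⁻¹ 0 = 2 by decide]
    simp; ring
  have e21 : vertex (Equiv.swap (0 : Fin 3) 1 * Equiv.swap 1 2) 1 = √2 := by
    rw [vertex_apply,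
      show (Equiv.swap (0 : Fin 3) 1 * Equiv.swap 1 2 : Equiv.Perm (Fin 3))⁻¹ 1 = 0 by decide]
    simp
  have e22 : vertex (Equiv.swap (0 : Fin 3) 1 * Equiv.swap 1 2) 2 = 0 := by
    rw [vertex_apply,
      show (Equiv.swap (0 : Fin 3) 1 * Equiv.swap 1 2 : Equiv.Perm (Fin 3))⁻¹ 2 = 1 by decide]
    simp
  convert hsum using 1
  ext i
  obtain rfl | rfl | rfl : i = 0 ∨ i = 1 ∨ i = 2 := by omega
  all_goals
    simp only [Fin.sum_univ_three, PiLp.add_apply, PiLp.smul_apply, smul_eq_mul,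
      Matrix.cons_val_zero, Matrix.cons_val_one, Matrix.cons_val, cornerVertex_zero,
      cornerVertex_one, cornerVertex_two, arcDir_zero_apply_zero, arcDir_zero_apply_one,
      arcDir_zero_apply_two, arcDir_end_apply_zero, arcDir_end_apply_one, arcDir_end_apply_two,
      e10, e11, e12, e20, e21, e22]
    ring

/-- The directions of the arc are nonnegative combinations of its ends, as both sines are
nonnegative for `0 ≤ s ≤ 2π/3`. -/
theorem arcDir_eq (s : ℝ) : arcDir s =
    (2 / √3 * Real.sin (2 * Real.pi / 3 - s)) • arcDir 0 +
      (2 / √3 * Real.sin s) • arcDir (2 * Real.pi / 3) := by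
  have h3 : √3 ≠ 0 := by positivity
  have h6 : √6 = 3 * √2 / √3 := by rw [eq_div_iff h3, mul_comm, sqrt_three_mul_sqrt_six]
  rw [Real.sin_sub, cos_two_pi_div_three, sin_two_pi_div_three]
  ext i
  obtain rfl | rfl | rfl : i = 0 ∨ i = 1 ∨ i = 2 := by omega
  all_goals
    simp only [PiLp.add_apply, PiLp.smul_apply, smul_eq_mul, arcDir_zero_apply_zero,
      arcDir_zero_apply_one, arcDir_zero_apply_two, arcDir_end_apply_zero, arcDir_end_apply_one,
      arcDir_end_apply_two]
    simp only [arcDir_apply_zero, arcDir_apply_one, arcDir_apply_two, h6]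
    field_simp
    ring

theorem cornerVertex_add_arcDir_mem {s t : ℝ} (hs : s ∈ Icc 0 (2 * Real.pi / 3)) (h0 : 0 ≤ t)
    (h1 : t ≤ 1 / 2) : cornerVertex + t • arcDir s ∈ permutohedron 3 := by
  have hpi := Real.pi_pos
  have ha : 0 ≤ 2 / √3 * Real.sin (2 * Real.pi / 3 - s) :=
    mul_nonneg (by positivity) (Real.sin_nonneg_of_nonneg_of_le_pi (by linarith [hs.2])
      (by linarith [hs.1]))
  have hb : 0 ≤ 2 / √3 * Real.sin s :=
    mul_nonneg (by positivity) (Real.sin_nonneg_of_nonneg_of_le_pi hs.1 (by linarith [hs.2]))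
  have h3 : 2 / √3 ≤ 2 := by
    rw [div_le_iff₀ (by positivity)]
    nlinarith [Real.one_le_sqrt.2 (by norm_num : (1 : ℝ) ≤ 3)]
  have h3' : 0 ≤ 2 / √3 := by positivity
  have := Real.sin_le_one (2 * Real.pi / 3 - s)
  have := Real.sin_le_one s
  rw [arcDir_eq, smul_add, smul_smul, smul_smul, ← add_assoc]
  refine cornerVertex_add_mem (by positivity) (by positivity) ?_
  nlinarith

/-! ### Two geodesics with the same endpoints -/

/-- For two coordinates `a` and `b` of a point of the hexagon, a function supported on the two
sectors in which they have the same sign. Each sector contains one of the two edges with block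
given by the two letters; there the function is the tent over the edge, and it vanishes on the
other edges. -/
def tent (a b : ℝ) : ℝ := max 0 (max (min a b) (min (-a) (-b)))

theorem tent_nonneg (a b : ℝ) : 0 ≤ tent a b := le_max_left _ _

theorem tent_le_add {a b a' b' M : ℝ} (ha : |a - a'| ≤ M) (hb : |b - b'| ≤ M) :
    tent a b ≤ tent a' b' + M := by
  have hM := (abs_nonneg _).trans ha
  rw [abs_le] at ha hb
  have h0 := tent_nonneg a' b'
  have h1 : min a' b' ≤ tent a' b' := (le_max_left _ _).trans (le_max_right _ _)
  have h2 : min (-a') (-b') ≤ tent a' b' := (le_max_right _ _).trans (le_max_right _ _)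
  refine max_le (by linarith) (max_le ?_ ?_)
  · rcases min_choice a' b' with h | h
    · exact (min_le_left _ _).trans (by linarith)
    · exact (min_le_right _ _).trans (by linarith)
  · rcases min_choice (-a') (-b') with h | h
    · exact (min_le_left _ _).trans (by linarith)
    · exact (min_le_right _ _).trans (by linarith)

theorem tent_cases (a b : ℝ) :
    tent a b = 0 ∨ (0 < a ∧ 0 < b ∧ tent a b ≤ a ∧ tent a b ≤ b) ∨
      (a < 0 ∧ b < 0 ∧ tent a b ≤ -a ∧ tent a b ≤ -b) := by
  by_cases h : 0 < a ∧ 0 < b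
  · right; left
    have h1 : min (-a) (-b) ≤ 0 := (min_le_left _ _).trans (by linarith [h.1])
    exact ⟨h.1, h.2,
      max_le h.1.le (max_le (min_le_left _ _) (h1.trans h.1.le)),
      max_le h.2.le (max_le (min_le_right _ _) (h1.trans h.2.le))⟩
  · have h1 : min a b ≤ 0 := by
      by_contra h'
      exact h (lt_min_iff.1 (not_le.1 h'))
    by_cases k : a < 0 ∧ b < 0
    · right; right
      have ha : 0 ≤ -a := by linarith [k.1]
      have hb : 0 ≤ -b := by linarith [k.2]
      exact ⟨k.1, k.2, max_le ha (max_le (h1.trans ha) (min_le_left _ _)),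
        max_le hb (max_le (h1.trans hb) (min_le_right _ _))⟩
    · left
      have h2 : min (-a) (-b) ≤ 0 := by
        by_contra h'
        have := lt_min_iff.1 (not_le.1 h')
        exact k ⟨by linarith [this.1], by linarith [this.2]⟩
      exact max_eq_left (max_le h1 h2)

theorem tent_eq_zero_of_abs_eq {i k l m : Fin 3} (hil : i ≠ k) (hlm : l = i ∨ l = k)
    (hm : m ≠ i ∧ m ≠ k)
    {x : E 3} (hx : x ∈ permutohedron 3) (hl : |x l| = √2) : tent (x i) (x k) = 0 := by
  have h2 : (0 : ℝ) < √2 := by positivity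
  have hs := add_add_eq_zero_of_mem hm.1 hm.2 hil hx
  have hm := abs_le.1 (abs_le_of_mem hx m)
  rw [abs_eq h2.le] at hl
  rcases tent_cases (x i) (x k) with h | ⟨h, h', _⟩ | ⟨h, h', _⟩
  · exact h
  all_goals
    exfalso
    rcases hlm with rfl | rfl <;> rcases hl with hl | hl <;> linarith

theorem tent_eq_of_abs_eq {i k l : Fin 3} (hli : l ≠ i) (hlk : l ≠ k) (hik : i ≠ k)
    {x : E 3} (hx : x ∈ permutohedron 3) (hl : |x l| = √2) :
    tent (x i) (x k) = (√2 - |x i - x k|) / 2 := by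
  have h2 : (0 : ℝ) < √2 := by positivity
  have hs := add_add_eq_zero_of_mem hli hlk hik hx
  have hi := abs_le.1 (abs_le_of_mem hx i)
  have hk := abs_le.1 (abs_le_of_mem hx k)
  have hp : ∀ a b : ℝ, 0 ≤ a → 0 ≤ b → tent a b = min a b := by
    intro a b ha hb
    have h1 : min (-a) (-b) ≤ 0 := (min_le_left _ _).trans (by linarith)
    rw [tent, max_eq_left (h1.trans (le_min ha hb)), max_eq_right (le_min ha hb)]
  have hn : ∀ a b : ℝ, a ≤ 0 → b ≤ 0 → tent a b = min (-a) (-b) := by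
    intro a b ha hb
    have h1 : min a b ≤ 0 := (min_le_left _ _).trans ha
    have h2 : 0 ≤ min (-a) (-b) := le_min (by linarith) (by linarith)
    rw [tent, max_eq_right (h1.trans h2), max_eq_right h2]
  rcases (abs_eq h2.le).1 hl with hl | hl
  · rw [hn _ _ (by linarith) (by linarith)]
    rcases le_total (x i) (x k) with h | h
    · rw [min_eq_right (by linarith), abs_of_nonpos (by linarith)]; linarith
    · rw [min_eq_left (by linarith), abs_of_nonneg (by linarith)]; linarith
  · rw [hp _ _ (by linarith) (by linarith)]
    rcases le_total (x i) (x k) with h | h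
    · rw [min_eq_left (by linarith), abs_of_nonpos (by linarith)]; linarith
    · rw [min_eq_right (by linarith), abs_of_nonneg (by linarith)]; linarith

/-- The tents over the edges with block `{0, i}`, in the cells with `w 0 < w i`. This function is
compatible with the identifications, that is, it descends to `Ω₃`. -/
def cellTent (i : Fin 3) (p : Cells 3) : ℝ :=
  if p.2 0 < p.2 i then tent ((p.1 : E 3) 0) ((p.1 : E 3) i) else 0

theorem cellTent_eq_of_rel {i : Fin 3} (hi : i ≠ 0) {p q : Cells 3} (h : Rel p q) :
    cellTent i p = cellTent i q := by
  have key : ∀ i : Fin 3, i ≠ 0 → ∃ m, m ≠ 0 ∧ m ≠ i := by decide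
  obtain ⟨m, hm0, hmi⟩ := key i hi
  have hzero : ∀ (p : Cells 3) (l : Fin 3), l ≠ m → |(p.1 : E 3) l| = √2 → cellTent i p = 0 := by
    intro p l hl h
    have : l = 0 ∨ l = i := by omega
    rw [cellTent, tent_eq_zero_of_abs_eq hi.symm this ⟨hm0, hmi⟩ p.1.2 h, ite_self]
  have hcorner : ∀ p : Cells 3, IsCorner p.1 → cellTent i p = 0 := by
    rintro p ⟨a, b, ha, hb⟩
    have h2 : (0 : ℝ) < √2 := by positivity
    have hab : a ≠ b := by rintro rfl; linarith
    by_cases h : a = m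
    · exact hzero p b (fun h' => hab (h.trans h'.symm)) (by rw [hb, abs_neg, abs_of_pos h2])
    · exact hzero p a h (by rw [ha, abs_of_pos h2])
  rcases h with rfl | ⟨h, h'⟩ | ⟨l, a, b, hla, hlb, hab, h⟩
  · rfl
  · rw [hcorner p h, hcorner q h']
  · by_cases hl : l = m
    · subst hl
      obtain ⟨rfl, rfl⟩ : a = 0 ∧ b = i := by omega
      have := h.2.2.2
      rw [cellTent, cellTent, tent_eq_of_abs_eq hla hlb hab.ne p.1.2 h.1,
        tent_eq_of_abs_eq hla hlb hab.ne q.1.2 h.2.1, h.2.2.1]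
      simp only [this]
    · rw [hzero p l hl h.1, hzero q l hl h.2.1]

/-- The difference of the tents over the two edges at the corner `213`. -/
def tentDiff (p : Cells 3) : ℝ := cellTent 1 p - cellTent 2 p

/-- The two tents are positive on disjoint pairs of sectors, so that their difference is still
`1`-Lipschitz for the maximum of the coordinates. -/
theorem tentDiff_sub_le {p q : Cells 3} (h : p.2 = q.2) {M : ℝ}
    (hM : ∀ i, |(p.1 : E 3) i - (q.1 : E 3) i| ≤ M) : tentDiff p - tentDiff q ≤ M := by
  have hM0 := (abs_nonneg _).trans (hM 0)
  have hstep : ∀ (p q : Cells 3) (i : Fin 3), p.2 = q.2 →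
      (∀ i, |(p.1 : E 3) i - (q.1 : E 3) i| ≤ M) → cellTent i p ≤ cellTent i q + M := by
    intro p q i h hM
    rw [cellTent, cellTent, h]
    split_ifs
    · exact tent_le_add (hM 0) (hM i)
    · linarith
  have h1 := hstep p q 1 h hM
  have h2 := hstep q p 2 h.symm fun i => by rw [abs_sub_comm]; exact hM i
  have hnn : ∀ (p : Cells 3) (i : Fin 3), 0 ≤ cellTent i p := by
    intro p i
    rw [cellTent]
    split_ifs
    · exact tent_nonneg _ _
    · exact le_rfl
  have hcases : ∀ (p : Cells 3) (i : Fin 3), cellTent i p = 0 ∨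
      (0 < (p.1 : E 3) 0 ∧ 0 < (p.1 : E 3) i ∧ cellTent i p ≤ (p.1 : E 3) 0 ∧
        cellTent i p ≤ (p.1 : E 3) i) ∨
      ((p.1 : E 3) 0 < 0 ∧ (p.1 : E 3) i < 0 ∧ cellTent i p ≤ -(p.1 : E 3) 0 ∧
        cellTent i p ≤ -(p.1 : E 3) i) := by
    intro p i
    rw [cellTent]
    split_ifs
    · exact tent_cases _ _
    · exact Or.inl rfl
  have hp1 := hnn p 1
  have hp2 := hnn p 2
  have hq1 := hnn q 1
  have hq2 := hnn q 2
  have hps := sum_eq_zero_of_mem p.1.2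
  have hqs := sum_eq_zero_of_mem q.1.2
  have hM0 := abs_le.1 (hM 0)
  have hM1 := abs_le.1 (hM 1)
  have hM2 := abs_le.1 (hM 2)
  rw [tentDiff, tentDiff]
  rcases hcases p 1 with h | ⟨h, h', k, k'⟩ | ⟨h, h', k, k'⟩
  · linarith
  all_goals
    rcases hcases q 2 with g | ⟨g, g', m, m'⟩ | ⟨g, g', m, m'⟩ <;> linarith

/-- A function which is `1`-Lipschitz for the maximum of the coordinates becomes `1`-Lipschitz for
the Euclidean metric after multiplication by `√(3/2)`. -/
theorem abs_le_dist_of_sub_le {F : Cells 3 → ℝ}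
    (hF : ∀ p q : Cells 3, p.2 = q.2 → ∀ M, (∀ i, |(p.1 : E 3) i - (q.1 : E 3) i| ≤ M) →
      F p - F q ≤ M) (p q : Cells 3) (h : p.2 = q.2) :
    |√(3 / 2) * F p - √(3 / 2) * F q| ≤ dist (p.1 : E 3) q.1 := by
  have h3 : 0 < √(3 / 2) := by positivity
  have hM : ∀ i, |(p.1 : E 3) i - (q.1 : E 3) i| ≤ dist (p.1 : E 3) q.1 / √(3 / 2) := fun i => by
    rw [le_div_iff₀ h3, mul_comm]
    exact sqrt_mul_abs_le_dist p.1.2 q.1.2 i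
  have h1 := hF p q h _ hM
  have h2 := hF q p h.symm _ fun i => by rw [abs_sub_comm]; exact hM i
  rw [le_div_iff₀ h3] at h1 h2
  rw [abs_le]
  constructor <;> linarith

theorem ofReal_tentDiff_le_edist (p q : Cells 3) :
    ENNReal.ofReal |√(3 / 2) * tentDiff p - √(3 / 2) * tentDiff q| ≤
      edist (toOmega p) (toOmega q) := by
  refine ofReal_abs_sub_le_edist (F := fun p => √(3 / 2) * tentDiff p) (fun p q h => ?_)
    (abs_le_dist_of_sub_le fun p q h M hM => tentDiff_sub_le h hM) p q
  simp only [tentDiff]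
  rw [cellTent_eq_of_rel (by decide) h, cellTent_eq_of_rel (by decide) h]

/-- The distance to the boundary of the hexagon of the cell `1`, up to a factor; it vanishes on the
other cells. -/
def boundaryDist (p : Cells 3) : ℝ :=
  if p.2 = 1 then
    min (√2 - |(p.1 : E 3) 0|) (min (√2 - |(p.1 : E 3) 1|) (√2 - |(p.1 : E 3) 2|)) else 0

theorem boundaryDist_eq_zero {p : Cells 3} {l : Fin 3} (h : |(p.1 : E 3) l| = √2) :
    boundaryDist p = 0 := by
  have h0 := sub_nonneg.2 (abs_le_of_mem p.1.2 0)
  have h1 := sub_nonneg.2 (abs_le_of_mem p.1.2 1)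
  have h2 := sub_nonneg.2 (abs_le_of_mem p.1.2 2)
  rw [boundaryDist]
  split_ifs
  · refine le_antisymm ?_ (le_min h0 (le_min h1 h2))
    obtain rfl | rfl | rfl : l = 0 ∨ l = 1 ∨ l = 2 := by omega
    · exact (min_le_left _ _).trans (by rw [h, sub_self])
    · exact (min_le_right _ _).trans ((min_le_left _ _).trans (by rw [h, sub_self]))
    · exact (min_le_right _ _).trans ((min_le_right _ _).trans (by rw [h, sub_self]))
  · rfl

theorem ofReal_boundaryDist_le_edist (p q : Cells 3) :
    ENNReal.ofReal |√(3 / 2) * boundaryDist p - √(3 / 2) * boundaryDist q| ≤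
      edist (toOmega p) (toOmega q) := by
  refine ofReal_abs_sub_le_edist (F := fun p => √(3 / 2) * boundaryDist p) (fun p q h => ?_)
    (abs_le_dist_of_sub_le fun p q h M hM => ?_) p q
  · have hc : ∀ p : Cells 3, IsCorner p.1 → boundaryDist p = 0 := by
      rintro p ⟨i, -, hi, -⟩
      exact boundaryDist_eq_zero (l := i) (by rw [hi, abs_of_pos (by positivity)])
    rcases h with rfl | ⟨h, h'⟩ | ⟨l, a, b, hla, hlb, hab, h⟩
    · rfl
    · simp only [hc p h, hc q h']
    · simp only [boundaryDist_eq_zero h.1, boundaryDist_eq_zero h.2.1]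
  · have hM' : ∀ i, √2 - |(p.1 : E 3) i| ≤ √2 - |(q.1 : E 3) i| + M := fun i => by
      have h1 := hM i
      have h2 := abs_sub_abs_le_abs_sub ((q.1 : E 3) i) ((p.1 : E 3) i)
      rw [abs_sub_comm] at h2
      linarith
    rw [boundaryDist, boundaryDist, h]
    split_ifs
    · rw [sub_le_iff_le_add', ← min_add_add_right, ← min_add_add_right]
      exact min_le_min (hM' 0) (min_le_min (hM' 1) (hM' 2))
    · rw [sub_self]
      exact (abs_nonneg _).trans (hM 0)

/-- A `1`-Lipschitz path is a geodesic as soon as its endpoints are at the right distance. -/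
theorem isGeodesic_of_le {X : Type*} [PseudoEMetricSpace X] {γ : ℝ → X} {ℓ : ℝ} (hℓ : 0 ≤ ℓ)
    (hle : ∀ s ∈ Icc 0 ℓ, ∀ t ∈ Icc 0 ℓ, edist (γ s) (γ t) ≤ ENNReal.ofReal |s - t|)
    (hge : ENNReal.ofReal ℓ ≤ edist (γ 0) (γ ℓ)) : IsGeodesic γ ℓ (γ 0) (γ ℓ) := by
  have key : ∀ s ∈ Icc 0 ℓ, ∀ t ∈ Icc 0 ℓ, s ≤ t →
      edist (γ s) (γ t) = ENNReal.ofReal |s - t| := by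
    intro s hs t ht hst
    refine le_antisymm (hle s hs t ht) ?_
    have h1 := hle 0 ⟨le_rfl, hℓ⟩ s hs
    have h2 := hle t ht ℓ ⟨hℓ, le_rfl⟩
    rw [abs_of_nonpos (by linarith [hs.1])] at h1
    rw [abs_of_nonpos (by linarith [ht.2])] at h2
    have h3 : ENNReal.ofReal ℓ ≤ ENNReal.ofReal (s + (ℓ - t)) + edist (γ s) (γ t) := by
      refine hge.trans ((edist_triangle4 _ (γ s) (γ t) _).trans ?_)
      rw [ENNReal.ofReal_add hs.1 (by linarith [ht.2])]
      calc _ ≤ ENNReal.ofReal s + edist (γ s) (γ t) + ENNReal.ofReal (ℓ - t) := by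
            gcongr
            · simpa using h1
            · simpa using h2
        _ = _ := by ring
    rw [← tsub_le_iff_left, ← ENNReal.ofReal_sub _ (by linarith [hs.1, ht.2])] at h3
    rwa [abs_of_nonpos (by linarith), show -(s - t) = ℓ - (s + (ℓ - t)) by ring]
  refine ⟨hℓ, rfl, rfl, fun s hs t ht => ?_⟩
  rcases le_total s t with h | h
  · exact key s hs t ht h
  · rw [edist_comm, abs_sub_comm]
    exact key t ht s hs h

/-- The segment cutting off the corner `213`, which joins the points at distance `t` from the vertex
on the two edges; it is parametrized by arc length. -/
def chord (t s : ℝ) : E 3 :=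
  cornerVertex + (t - s / √3) • arcDir 0 + (s / √3) • arcDir (2 * Real.pi / 3)

theorem chord_apply_zero (t s : ℝ) : chord t s 0 = (t - 2 * (s / √3)) * (√2 / 2) := by
  simp only [chord, PiLp.add_apply, PiLp.smul_apply, smul_eq_mul, cornerVertex_zero,
    arcDir_zero_apply_zero, arcDir_end_apply_zero]
  ring

theorem chord_apply_one (t s : ℝ) : chord t s 1 = √2 - (t - s / √3) * (√2 / 2) := by
  simp only [chord, PiLp.add_apply, PiLp.smul_apply, smul_eq_mul, cornerVertex_one,
    arcDir_zero_apply_one, arcDir_end_apply_one]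
  ring

theorem chord_apply_two (t s : ℝ) : chord t s 2 = -√2 + s / √3 * (√2 / 2) := by
  simp only [chord, PiLp.add_apply, PiLp.smul_apply, smul_eq_mul, cornerVertex_two,
    arcDir_zero_apply_two, arcDir_end_apply_two]
  ring

theorem chord_mem {t s : ℝ} (ht : t ≤ 1 / 2) (hs : s ∈ Icc 0 (√3 * t)) :
    chord t s ∈ permutohedron 3 := by
  have h3 : 0 < √3 := by positivity
  refine cornerVertex_add_mem ?_ (div_nonneg hs.1 h3.le) (by linarith)
  rw [sub_nonneg, div_le_iff₀ h3, mul_comm]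
  exact hs.2

theorem dist_chord (t s s' : ℝ) : dist (chord t s) (chord t s') = |s - s'| := by
  have h : dist (chord t s) (chord t s') ^ 2 = |s - s'| ^ 2 := by
    rw [dist_sq_eq, sq_abs]
    simp only [chord_apply_zero, chord_apply_one, chord_apply_two]
    have h3 : √3 ≠ 0 := by positivity
    have e : (s - s') = √3 * (s / √3 - s' / √3) := by field_simp
    rw [e]
    linear_combination (3 / 2) * (s / √3 - s' / √3) ^ 2 * sqrt_two_mul_self -
      (s / √3 - s' / √3) ^ 2 * sqrt_three_mul_self
  exact (pow_left_inj₀ dist_nonneg (abs_nonneg _) two_ne_zero).1 h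

theorem dist_chord_cornerVertex_le {t s : ℝ} (hs : s ∈ Icc 0 (√3 * t)) :
    dist (chord t s) cornerVertex ≤ t := by
  have h3 : 0 < √3 := by positivity
  have h1 : 0 ≤ s / √3 := div_nonneg hs.1 h3.le
  have h2 : s / √3 ≤ t := by rw [div_le_iff₀ h3, mul_comm]; exact hs.2
  refine le_of_sq_le_sq ?_ (h1.trans h2)
  rw [dist_sq_eq]
  simp only [chord_apply_zero, chord_apply_one, chord_apply_two, cornerVertex_zero,
    cornerVertex_one, cornerVertex_two]
  have e : ∀ c : ℝ, (c * (√2 / 2)) ^ 2 = c ^ 2 / 2 := fun c => by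
    linear_combination c ^ 2 / 4 * sqrt_two_mul_self
  rw [sub_zero, e, show √2 - (t - s / √3) * (√2 / 2) - √2 = (-(t - s / √3)) * (√2 / 2) by ring, e,
    show -√2 + s / √3 * (√2 / 2) - -√2 = s / √3 * (√2 / 2) by ring, e]
  nlinarith

theorem theVertex_eq (w : Equiv.Perm (Fin 3)) :
    toOmega (⟨cornerVertex, cornerVertex_mem⟩, w) = theVertex :=
  toOmega_vertex_eq _ _ _ _

theorem tentDiff_chord_zero {t : ℝ} (ht : t ≤ 1 / 2) {w : Equiv.Perm (Fin 3)}
    (hw : w 0 < w 1) (h : chord t 0 ∈ permutohedron 3) :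
    tentDiff (⟨chord t 0, h⟩, w) = t * (√2 / 2) := by
  have h2 : 0 < √2 := by positivity
  have hl : |chord t 0 2| = √2 := by simp [chord_apply_two, abs_of_pos h2]
  rw [tentDiff, cellTent, cellTent, if_pos hw]
  simp only
  rw [tent_eq_of_abs_eq (l := 2) (by decide) (by decide) (by decide) h hl,
    tent_eq_zero_of_abs_eq (l := 2) (m := 1) (by decide) (by decide) (by decide) h hl, ite_self,
    chord_apply_zero, chord_apply_one, abs_of_nonpos]
  · simp; ring
  · have := mul_le_mul_of_nonneg_right ht h2.le
    simp
    linarith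

theorem tentDiff_chord_end {t : ℝ} (ht : t ≤ 1 / 2) {w : Equiv.Perm (Fin 3)}
    (hw : w 0 < w 2) (h : chord t (√3 * t) ∈ permutohedron 3) :
    tentDiff (⟨chord t (√3 * t), h⟩, w) = -(t * (√2 / 2)) := by
  have h2 : 0 < √2 := by positivity
  have h3 : √3 * t / √3 = t := by field_simp
  have hl : |chord t (√3 * t) 1| = √2 := by simp [chord_apply_one, h3, abs_of_pos h2]
  rw [tentDiff, cellTent, cellTent, if_pos hw]
  simp only
  rw [tent_eq_of_abs_eq (i := 0) (k := 2) (l := 1) (by decide) (by decide) (by decide) h hl,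
    tent_eq_zero_of_abs_eq (i := 0) (k := 1) (l := 1) (m := 2) (by decide) (by decide) (by decide)
      h hl, ite_self, chord_apply_zero, chord_apply_two, h3, abs_of_nonneg]
  · ring
  · have := mul_le_mul_of_nonneg_right ht h2.le
    linarith

theorem toOmega_chord_zero {t : ℝ} (h : chord t 0 ∈ permutohedron 3) :
    toOmega (⟨chord t 0, h⟩, 1) = toOmega (⟨chord t 0, h⟩, Equiv.swap 1 2) := by
  have h2 : 0 < √2 := by positivity
  have hl : |chord t 0 2| = √2 := by simp [chord_apply_two, abs_of_pos h2]
  exact EdgeRel.toOmega_eq (l := 2) (i := 0) (j := 1) (by decide) (by decide) (by decide)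
    ⟨hl, hl, rfl, (by decide :
      (1 : Equiv.Perm (Fin 3)) 0 < (1 : Equiv.Perm (Fin 3)) 1 ↔
        Equiv.swap (1 : Fin 3) 2 0 < Equiv.swap (1 : Fin 3) 2 1)⟩

theorem toOmega_chord_end {t : ℝ} (h : chord t (√3 * t) ∈ permutohedron 3) :
    toOmega (⟨chord t (√3 * t), h⟩, 1) = toOmega (⟨chord t (√3 * t), h⟩, Equiv.swap 1 2) := by
  have h2 : 0 < √2 := by positivity
  have h3 : √3 * t / √3 = t := by field_simp
  have hl : |chord t (√3 * t) 1| = √2 := by simp [chord_apply_one, h3, abs_of_pos h2]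
  exact EdgeRel.toOmega_eq (l := 1) (i := 0) (j := 2) (by decide) (by decide) (by decide)
    ⟨hl, hl, rfl, (by decide :
      (1 : Equiv.Perm (Fin 3)) 0 < (1 : Equiv.Perm (Fin 3)) 2 ↔
        Equiv.swap (1 : Fin 3) 2 0 < Equiv.swap (1 : Fin 3) 2 2)⟩

/-- In every ball around the vertex, the segments cutting off the corner `213` in the cells `1` and
`(2 3)` are two different geodesics with the same endpoints. -/
theorem not_isLocallyCAT0 : ¬ IsLocallyCAT0 (Omega 3) := by
  intro h
  obtain ⟨r, hr, hcat⟩ := h theVertex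
  set t : ℝ := min (r / 2) (1 / 2) with ht
  have ht0 : 0 < t := lt_min (by linarith) (by norm_num)
  have ht1 : t ≤ 1 / 2 := min_le_right _ _
  have htr : t < r := (min_le_left _ _).trans_lt (by linarith)
  have h3 : 0 < √3 := by positivity
  set ℓ : ℝ := √3 * t with hℓ
  have hℓ0 : 0 < ℓ := mul_pos h3 ht0
  -- Geodesics are functions on the whole line; outside `[0, ℓ]` the path is constant.
  let σ : ℝ → ℝ := fun s => max 0 (min s ℓ)
  have hσ : ∀ s, σ s ∈ Icc 0 ℓ := fun s => ⟨le_max_left _ _, max_le hℓ0.le (min_le_right _ _)⟩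
  have hσ' : ∀ s ∈ Icc 0 ℓ, σ s = s := fun s hs => by
    simp only [σ]
    rw [min_eq_left hs.2, max_eq_right hs.1]
  let pt : Equiv.Perm (Fin 3) → ℝ → Omega 3 := fun w s =>
    toOmega (⟨chord t (σ s), chord_mem ht1 (hσ s)⟩, w)
  have hpt : ∀ w s, pt w s ∈ Metric.eball theVertex (ENNReal.ofReal r) := by
    intro w s
    rw [Metric.mem_eball, ← theVertex_eq w]
    refine (edist_toOmega_le _ _).trans_lt ?_
    rw [ENNReal.ofReal_lt_ofReal_iff hr]
    exact (dist_chord_cornerVertex_le (hσ s)).trans_lt htr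
  let γ : Equiv.Perm (Fin 3) → ℝ → Metric.eball theVertex (ENNReal.ofReal r) := fun w s =>
    ⟨pt w s, hpt w s⟩
  have hσ0 := hσ' 0 ⟨le_rfl, hℓ0.le⟩
  have hσℓ := hσ' ℓ ⟨hℓ0.le, le_rfl⟩
  have hpt_eq : ∀ w s (hs : s ∈ Icc 0 ℓ), pt w s = toOmega (⟨chord t s, chord_mem ht1 hs⟩, w) := by
    intro w s hs
    simp only [pt, hσ' s hs]
  have hgeo : ∀ w : Equiv.Perm (Fin 3), w 0 < w 1 → w 0 < w 2 →
      IsGeodesic (γ w) ℓ (γ w 0) (γ w ℓ) := by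
    intro w hw1 hw2
    refine isGeodesic_of_le hℓ0.le (fun s hs s' hs' => ?_) ?_
    · change edist (pt w s) (pt w s') ≤ _
      rw [hpt_eq w s hs, hpt_eq w s' hs']
      refine (edist_toOmega_le _ _).trans (le_of_eq ?_)
      rw [dist_chord]
    · change _ ≤ edist (pt w 0) (pt w ℓ)
      rw [hpt_eq w 0 ⟨le_rfl, hℓ0.le⟩, hpt_eq w ℓ ⟨hℓ0.le, le_rfl⟩]
      refine le_trans (le_of_eq ?_) (ofReal_tentDiff_le_edist _ _)
      rw [tentDiff_chord_zero ht1 hw1, tentDiff_chord_end ht1 hw2]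
      congr 1
      have : √(3 / 2) * √2 = √3 := by
        rw [← Real.sqrt_mul (by norm_num)]; norm_num
      rw [show √(3 / 2) * (t * (√2 / 2)) - √(3 / 2) * -(t * (√2 / 2)) = √(3 / 2) * √2 * t by ring,
        this, abs_of_pos hℓ0]
  have hg1 := hgeo 1 (by decide) (by decide)
  have hg2 := hgeo (Equiv.swap 1 2) (by decide) (by decide)
  have e0 : γ (Equiv.swap 1 2) 0 = γ 1 0 := Subtype.ext <| by
    change pt _ 0 = pt _ 0
    rw [hpt_eq _ 0 ⟨le_rfl, hℓ0.le⟩, hpt_eq _ 0 ⟨le_rfl, hℓ0.le⟩, toOmega_chord_zero]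
  have eℓ : γ (Equiv.swap 1 2) ℓ = γ 1 ℓ := Subtype.ext <| by
    change pt _ ℓ = pt _ ℓ
    rw [hpt_eq _ ℓ ⟨hℓ0.le, le_rfl⟩, hpt_eq _ ℓ ⟨hℓ0.le, le_rfl⟩, toOmega_chord_end]
  rw [e0, eℓ] at hg2
  -- The comparison triangle is degenerate, so that the midpoints of the two geodesics coincide.
  let y' : EuclideanSpace ℝ (Fin 2) := EuclideanSpace.single 0 ℓ
  let p' : EuclideanSpace ℝ (Fin 2) := EuclideanSpace.single 0 (ℓ / 2)
  have hmid : ℓ / 2 ∈ Icc 0 ℓ := ⟨by linarith, by linarith⟩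
  have hy' : edist (0 : EuclideanSpace ℝ (Fin 2)) y' = edist (γ 1 0) (γ 1 ℓ) := by
    rw [hg1.2.2.2 0 ⟨le_rfl, hℓ0.le⟩ ℓ ⟨hℓ0.le, le_rfl⟩, edist_dist, dist_zero_left]
    simp [y']
  have hp' : dist (0 : EuclideanSpace ℝ (Fin 2)) p' = ℓ / 2 := by
    rw [dist_zero_left]
    simp [p', abs_of_pos hℓ0]
  have hseg : p' ∈ segment ℝ (0 : EuclideanSpace ℝ (Fin 2)) y' := by
    refine ⟨1 / 2, 1 / 2, by norm_num, by norm_num, by norm_num, ?_⟩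
    ext i
    fin_cases i <;> simp [p', y']; ring
  have hle := hcat.2 (γ 1 0) (γ 1 ℓ) (γ 1 ℓ) (γ 1) (γ (Equiv.swap 1 2)) ℓ ℓ hg1 hg2 0 y' y' hy' hy'
    (by simp) (ℓ / 2) hmid (ℓ / 2) hmid p' hseg p' hseg hp' hp'
  rw [edist_self] at hle
  change edist (pt 1 (ℓ / 2)) (pt (Equiv.swap 1 2) (ℓ / 2)) ≤ 0 at hle
  rw [hpt_eq _ _ hmid, hpt_eq _ _ hmid] at hle
  have hlow := (ofReal_boundaryDist_le_edist _ _).trans hle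
  have hs : ℓ / 2 / √3 = t / 2 := by rw [hℓ]; field_simp
  have h2 : 0 < √2 := by positivity
  have h2' : t * √2 ≤ 1 / 2 * √2 := mul_le_mul_of_nonneg_right ht1 h2.le
  have h2'' : 0 < t * √2 := mul_pos ht0 h2
  have hpos : 0 < boundaryDist (⟨chord t (ℓ / 2), chord_mem ht1 hmid⟩, 1) := by
    rw [boundaryDist, if_pos rfl]
    simp only [chord_apply_zero, chord_apply_one, chord_apply_two, hs]
    refine lt_min ?_ (lt_min ?_ ?_) <;> rw [sub_pos, abs_lt] <;> constructor <;> linarith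
  have hzero : boundaryDist (⟨chord t (ℓ / 2), chord_mem ht1 hmid⟩, Equiv.swap 1 2) = 0 :=
    if_neg (by decide : ¬ (Equiv.swap (1 : Fin 3) 2 = 1))
  rw [hzero, mul_zero, sub_zero, nonpos_iff_eq_zero, ENNReal.ofReal_eq_zero, abs_nonpos_iff] at hlow
  exact (mul_pos (by positivity : 0 < √(3 / 2)) hpos).ne' hlow

/-! ### Identifications in the link of the vertex -/

theorem vertex_apply_cases (u : Equiv.Perm (Fin 3)) (i : Fin 3) :
    vertex u i = √2 ∨ vertex u i = 0 ∨ vertex u i = -√2 := by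
  rw [vertex_apply]
  obtain h | h | h : u⁻¹ i = 0 ∨ u⁻¹ i = 1 ∨ u⁻¹ i = 2 := by omega
  · left; rw [h]; simp
  · right; left; rw [h]; simp
  · right; right; rw [h]; simp; ring

/-- Different vertices of the hexagon differ by at least `√2` in some coordinate. -/
theorem eq_zero_of_vertex_add_eq {u v : Equiv.Perm (Fin 3)} {y : E 3}
    (h : vertex u + y = vertex v) (hy : ∀ i, |y i| < √2) : y = 0 := by
  ext i
  have h' : vertex u i + y i = vertex v i := by rw [← h]; rfl
  have hi := abs_lt.1 (hy i)
  change y i = 0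
  rcases vertex_apply_cases u i with hu | hu | hu <;>
    rcases vertex_apply_cases v i with hv | hv | hv <;> linarith

theorem PreLink.ext_of_eq {p : Omega 3} {a b : PreLink p} (h1 : a.cell = b.cell)
    (h2 : a.base = b.base) (h3 : a.dir = b.dir) : a = b := by
  cases a; cases b
  simp only at h1 h2 h3
  subst h1 h2 h3
  rfl

theorem PreLink.exists_base_eq (a : PreLink theVertex) : ∃ u, (a.base : E 3) = vertex u :=
  toOmega_eq_theVertex a.toOmega_eq

theorem PreLink.exists_inward {p : Omega 3} (a : PreLink p) :
    ∃ t : ℝ, 0 < t ∧ (a.base : E 3) + t • a.dir ∈ permutohedron 3 := by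
  obtain ⟨t, ht, h⟩ := (a.inward.and self_mem_nhdsWithin).exists
  exact ⟨t, h, ht⟩

theorem PreLink.dir_sum {p : Omega 3} (a : PreLink p) : a.dir 0 + a.dir 1 + a.dir 2 = 0 := by
  obtain ⟨t, ht, h⟩ := a.exists_inward
  have h1 := sum_eq_zero_of_mem h
  have h2 := sum_eq_zero_of_mem a.base.2
  simp only [PiLp.add_apply, PiLp.smul_apply, smul_eq_mul] at h1
  have : t * (a.dir 0 + a.dir 1 + a.dir 2) = 0 := by linear_combination h1 - h2
  exact (mul_eq_zero.1 this).resolve_left ht.ne'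

theorem PreLink.dir_nonpos {p : Omega 3} (a : PreLink p) {i : Fin 3} (hi : (a.base : E 3) i = √2) :
    a.dir i ≤ 0 := by
  obtain ⟨t, ht, h⟩ := a.exists_inward
  have h1 := (abs_le.1 (abs_le_of_mem h i)).2
  simp only [PiLp.add_apply, PiLp.smul_apply, smul_eq_mul, hi] at h1
  by_contra h'
  nlinarith [mul_pos ht (not_le.1 h')]

theorem PreLink.dir_nonneg {p : Omega 3} (a : PreLink p) {i : Fin 3} (hi : (a.base : E 3) i = -√2) :
    0 ≤ a.dir i := by
  obtain ⟨t, ht, h⟩ := a.exists_inward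
  have h1 := (abs_le.1 (abs_le_of_mem h i)).1
  simp only [PiLp.add_apply, PiLp.smul_apply, smul_eq_mul, hi] at h1
  by_contra h'
  nlinarith [mul_neg_of_pos_of_neg ht (not_le.1 h')]

theorem PreLink.dir_sq {p : Omega 3} (a : PreLink p) :
    a.dir 0 ^ 2 + a.dir 1 ^ 2 + a.dir 2 ^ 2 = 1 := by
  have h := real_inner_self_eq_norm_sq a.dir
  rw [a.norm_dir, inner_eq] at h
  linarith

theorem PreLink.abs_dir_le {p : Omega 3} (a : PreLink p) (i : Fin 3) : |a.dir i| ≤ 1 := by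
  rw [← a.norm_dir]
  exact PiLp.norm_apply_le a.dir i

/-- The directions `a` and `b` belong to edges with block `{i, j}` which are identified, and they
point into these edges from corresponding ends. Here `l` is the letter outside the block. -/
def LinkRel (l i j : Fin 3) (a b : PreLink theVertex) : Prop :=
  a.dir l = 0 ∧ b.dir l = 0 ∧ |(a.base : E 3) l| = √2 ∧ |(b.base : E 3) l| = √2 ∧
    (a.base : E 3) i - (a.base : E 3) j = (b.base : E 3) i - (b.base : E 3) j ∧
    (a.cell i < a.cell j ↔ b.cell i < b.cell j)

theorem LinkRel.symm {l i j : Fin 3} {a b : PreLink theVertex} (h : LinkRel l i j a b) :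
    LinkRel l i j b a :=
  ⟨h.2.1, h.1, h.2.2.2.1, h.2.2.1, h.2.2.2.2.1.symm, h.2.2.2.2.2.symm⟩

/-- The direction of an edge at a vertex is determined by the signs of the coordinates. -/
theorem PreLink.dir_eq_of_edge {l i j : Fin 3} (hli : l ≠ i) (hlj : l ≠ j) (hij : i ≠ j)
    {p : Omega 3} (a : PreLink p) (hl : a.dir l = 0) (hb : |(a.base : E 3) l| = √2)
    (hd : (a.base : E 3) i - (a.base : E 3) j = √2) :
    a.dir i = -(√2 / 2) ∧ a.dir j = √2 / 2 := by
  have h2 : (0 : ℝ) < √2 := by positivity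
  have hs := add_add_eq_zero_of_mem hli hlj hij a.base.2
  have hds := (add_add_eq_of_ne hli hlj hij a.dir).trans a.dir_sum
  have hsq : a.dir l ^ 2 + a.dir i ^ 2 + a.dir j ^ 2 = 1 := by
    rw [← a.dir_sq]
    fin_cases l <;> fin_cases i <;> fin_cases j <;> simp at * <;> ring
  have hi : a.dir i ≤ 0 := by
    rcases (abs_eq h2.le).1 hb with h | h
    · have := a.dir_nonneg (i := j) (by linarith)
      linarith
    · exact a.dir_nonpos (by linarith)
  have hji : a.dir j = -a.dir i := by linarith
  rw [hl, hji] at hsq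
  have : (a.dir i) ^ 2 = (-(√2 / 2)) ^ 2 := by linear_combination hsq / 2 - sqrt_two_mul_self / 4
  have hi' : a.dir i = -(√2 / 2) := by
    rcases sq_eq_sq_iff_eq_or_eq_neg.1 this with h | h
    · exact h
    · linarith
  exact ⟨hi', by rw [hji, hi', neg_neg]⟩

theorem PreLink.base_sub_cases {l i j : Fin 3} (hli : l ≠ i) (hlj : l ≠ j) (hij : i ≠ j)
    (a : PreLink theVertex) (hb : |(a.base : E 3) l| = √2) :
    (a.base : E 3) i - (a.base : E 3) j = √2 ∨ (a.base : E 3) j - (a.base : E 3) i = √2 := by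
  have hc : IsCorner a.base := by
    obtain ⟨u, hu⟩ := a.exists_base_eq
    rw [hu]
    exact isCorner_vertex u
  rw [isCorner_iff hli hlj hij a.base.2 hb, abs_eq (by positivity)] at hc
  rcases hc with h | h
  · exact Or.inl h
  · exact Or.inr (by linarith)

theorem LinkRel.dir_eq {l i j : Fin 3} (hli : l ≠ i) (hlj : l ≠ j) (hij : i ≠ j)
    {a b : PreLink theVertex} (h : LinkRel l i j a b) : a.dir = b.dir := by
  obtain ⟨ha, hb, hal, hbl, hd, -⟩ := h
  rcases a.base_sub_cases hli hlj hij hal with h | h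
  · have h1 := a.dir_eq_of_edge hli hlj hij ha hal h
    have h2 := b.dir_eq_of_edge hli hlj hij hb hbl (hd ▸ h)
    exact ext_of_ne hli hlj hij (ha.trans hb.symm) (h1.1.trans h2.1.symm) (h1.2.trans h2.2.symm)
  · have h1 := a.dir_eq_of_edge hlj hli hij.symm ha hal h
    have h2 := b.dir_eq_of_edge hlj hli hij.symm hb hbl (by linarith)
    exact ext_of_ne hli hlj hij (ha.trans hb.symm) (h1.2.trans h2.2.symm) (h1.1.trans h2.1.symm)

theorem LinkRel.toLink_eq {l i j : Fin 3} (hli : l ≠ i) (hlj : l ≠ j) (hij : i < j)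
    {a b : PreLink theVertex} (h : LinkRel l i j a b) : toLink a = toLink b := by
  have hdir := h.dir_eq hli hlj hij.ne
  obtain ⟨ha, hb, hal, hbl, hd, hw⟩ := h
  refine Quotient.sound ?_
  change ∀ᶠ t in 𝓝[>] (0 : ℝ), _
  filter_upwards [a.inward, b.inward] with t hta htb
  refine ⟨hta, htb, EdgeRel.toOmega_eq hli hlj hij ⟨?_, ?_, ?_, hw⟩⟩
  · simpa [ha] using hal
  · simpa [hb] using hbl
  · simp only [PiLp.add_apply, PiLp.smul_apply, smul_eq_mul, hdir]
    linarith

/-- Two directions at the vertex define the same point of the link only if they are equal or belong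
to identified edges. -/
theorem eq_or_linkRel_of_toLink_eq {a b : PreLink theVertex} (h : toLink a = toLink b) :
    a = b ∨ ∃ l i j, l ≠ i ∧ l ≠ j ∧ i < j ∧ LinkRel l i j a b := by
  have h' : ∀ᶠ t in 𝓝[>] (0 : ℝ), ∃ (ha : (a.base : E 3) + t • a.dir ∈ permutohedron 3)
    (hb : (b.base : E 3) + t • b.dir ∈ permutohedron 3),
      toOmega (⟨_, ha⟩, a.cell) = toOmega (⟨_, hb⟩, b.cell) := Quotient.exact h
  have hnhds : Ioo (0 : ℝ) (1 / 2) ∈ 𝓝[>] (0 : ℝ) := Ioo_mem_nhdsGT (by norm_num)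
  obtain ⟨t, ⟨ha, hb, he⟩, ht⟩ := (h'.and hnhds).exists
  obtain ⟨u, hu⟩ := a.exists_base_eq
  obtain ⟨v, hv⟩ := b.exists_base_eq
  have h2 : 1 < √2 := Real.lt_sqrt_of_sq_lt (by norm_num)
  have hsmall : ∀ (a : PreLink theVertex) (i : Fin 3), |t * a.dir i| < 1 / 2 := fun a i => by
    rw [abs_mul, abs_of_pos ht.1]
    nlinarith [a.abs_dir_le i, abs_nonneg (a.dir i), ht.1, ht.2]
  -- Both directions being unit vectors, the points at time `t` are not vertices.
  have hcorner : ∀ (a : PreLink theVertex), (a.base : E 3) + t • a.dir ∈ permutohedron 3 →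
      ¬ IsCorner ((a.base : E 3) + t • a.dir) := by
    intro a ha hc
    obtain ⟨v, hv⟩ := hc.exists_eq_vertex ha
    obtain ⟨u, hu⟩ := a.exists_base_eq
    rw [hu] at hv
    have h0 := eq_zero_of_vertex_add_eq hv fun i => (hsmall a i).trans (by linarith)
    rcases smul_eq_zero.1 h0 with h0 | h0
    · exact ht.1.ne' h0
    · have := a.norm_dir
      simp [h0] at this
  rcases toOmega_eq_imp he with he | ⟨hc, -⟩ | ⟨l, i, j, hli, hlj, hij, hl, hl', hd, hw⟩
  · left
    simp only [Prod.mk.injEq, Subtype.mk.injEq] at he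
    obtain ⟨he, hcell⟩ := he
    have h0 : (t • a.dir - t • b.dir : E 3) = 0 := by
      refine eq_zero_of_vertex_add_eq (u := u) (v := v) ?_ fun i => ?_
      · rw [← hu, ← hv, add_sub, he, add_sub_cancel_right]
      · have h1 := abs_lt.1 (hsmall a i)
        have h2 := abs_lt.1 (hsmall b i)
        change |t * a.dir i - t * b.dir i| < √2
        rw [abs_lt]
        constructor <;> linarith
    have hdir : a.dir = b.dir := smul_right_injective _ ht.1.ne' (sub_eq_zero.1 h0)
    rw [hdir] at he
    exact PreLink.ext_of_eq hcell (Subtype.ext (add_right_cancel he)) hdir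
  · exact absurd hc (hcorner a ha)
  · right
    have hlcoord : ∀ (a : PreLink theVertex), |((a.base : E 3) + t • a.dir) l| = √2 →
        a.dir l = 0 ∧ |(a.base : E 3) l| = √2 := by
      intro a hl
      obtain ⟨u, hu⟩ := a.exists_base_eq
      have hs := abs_lt.1 (hsmall a l)
      simp only [PiLp.add_apply, PiLp.smul_apply, smul_eq_mul] at hl
      rw [hu] at hl ⊢
      have h0 : t * a.dir l = 0 ∧ |vertex u l| = √2 := by
        rcases (abs_eq (by linarith)).1 hl with hl | hl <;>
          rcases vertex_apply_cases u l with h | h | h <;> rw [h] at hl ⊢ <;>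
          first
          | exact ⟨by linarith, abs_of_pos (by linarith)⟩
          | exact ⟨by linarith, by rw [abs_neg]; exact abs_of_pos (by linarith)⟩
          | (exfalso; linarith)
      exact ⟨(mul_eq_zero.1 h0.1).resolve_left ht.1.ne', h0.2⟩
    obtain ⟨hal, hal'⟩ := hlcoord a hl
    obtain ⟨hbl, hbl'⟩ := hlcoord b hl'
    refine ⟨l, i, j, hli, hlj, hij, hal, hbl, hal', hbl', ?_, hw⟩
    simp only [PiLp.add_apply, PiLp.smul_apply, smul_eq_mul] at hd
    have h1 := abs_lt.1 (hsmall a i)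
    have h2 := abs_lt.1 (hsmall a j)
    have h3 := abs_lt.1 (hsmall b i)
    have h4 := abs_lt.1 (hsmall b j)
    rcases a.base_sub_cases hli hlj hij.ne hal' with h | h <;>
      rcases b.base_sub_cases hli hlj hij.ne hbl' with h' | h' <;> linarith

/-- A function on the link of the vertex, given by its values on directions. -/
def linkLift {Y : Type*} (F : PreLink theVertex → Y)
    (hF : ∀ a b l i j, l ≠ i → l ≠ j → i < j → LinkRel l i j a b → F a = F b)
    (x : Link theVertex) : Y :=
  Quotient.lift F (fun a b h => by
    rcases eq_or_linkRel_of_toLink_eq (Quotient.sound h) with h | ⟨l, i, j, hli, hlj, hij, h⟩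
    · rw [h]
    · exact hF a b l i j hli hlj hij h) x

theorem edist_linkLift_le {Y : Type*} [PseudoEMetricSpace Y] {F : PreLink theVertex → Y}
    (hF : ∀ a b l i j, l ≠ i → l ≠ j → i < j → LinkRel l i j a b → F a = F b)
    (hL : ∀ a b : PreLink theVertex, a.cell = b.cell → a.base = b.base →
      edist (F a) (F b) ≤ ENNReal.ofReal (InnerProductGeometry.angle a.dir b.dir))
    (x y : Link theVertex) : edist (linkLift F hF x) (linkLift F hF y) ≤ edist x y := by
  refine edist_le_stringEDist (π := toLink) (c := angleEDist) (f := linkLift F hF)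
    (fun a b => ?_) x y
  by_cases h : a.cell = b.cell ∧ a.base = b.base
  · rw [angleEDist, if_pos h]
    exact hL a b h.1 h.2
  · simp [angleEDist, h]

/-! ### The two arcs -/

theorem two_pi_div_three_nonneg : (0 : ℝ) ≤ 2 * Real.pi / 3 := by positivity

/-- A direction at the corner `213` of the cell `w`. -/
def arcPreLink (w : Equiv.Perm (Fin 3)) (s : Icc (0 : ℝ) (2 * Real.pi / 3)) :
    PreLink theVertex where
  cell := w
  base := ⟨cornerVertex, cornerVertex_mem⟩
  toOmega_eq := theVertex_eq w
  dir := arcDir s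
  norm_dir := norm_arcDir s
  inward := by
    filter_upwards [Ioo_mem_nhdsGT (by norm_num : (0 : ℝ) < 1 / 2)] with t ht
    exact cornerVertex_add_arcDir_mem s.2 ht.1.le ht.2.le

/-- The arc of directions at the corner `213` of the cell `w`, parametrized by angle and extended by
constants outside `[0, 2π/3]`. -/
def arc (w : Equiv.Perm (Fin 3)) (s : ℝ) : Link theVertex :=
  toLink (arcPreLink w (projIcc 0 (2 * Real.pi / 3) two_pi_div_three_nonneg s))

theorem arc_of_mem (w : Equiv.Perm (Fin 3)) {s : ℝ} (hs : s ∈ Icc 0 (2 * Real.pi / 3)) :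
    arc w s = toLink (arcPreLink w ⟨s, hs⟩) := by
  rw [arc, projIcc_of_mem]

theorem angle_arcDir {s t : ℝ} (hs : s ∈ Icc 0 (2 * Real.pi / 3))
    (ht : t ∈ Icc 0 (2 * Real.pi / 3)) :
    InnerProductGeometry.angle (arcDir s) (arcDir t) = |s - t| := by
  rw [InnerProductGeometry.angle, norm_arcDir, norm_arcDir, inner_arcDir, mul_one, div_one,
    ← Real.cos_abs, Real.arccos_cos (abs_nonneg _)]
  rw [abs_le]
  constructor <;> linarith [hs.1, hs.2, ht.1, ht.2, Real.pi_pos]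

theorem edist_arc_le (w : Equiv.Perm (Fin 3)) (s t : ℝ) :
    edist (arc w s) (arc w t) ≤ ENNReal.ofReal |s - t| := by
  refine (stringEDist_le toLink angleEDist _ _).trans ?_
  rw [angleEDist, if_pos ⟨rfl, rfl⟩]
  refine ENNReal.ofReal_le_ofReal ?_
  change InnerProductGeometry.angle (arcDir _) (arcDir _) ≤ _
  rw [angle_arcDir (Subtype.coe_prop _) (Subtype.coe_prop _)]
  exact abs_projIcc_sub_projIcc _

theorem continuous_arc (w : Equiv.Perm (Fin 3)) : Continuous (arc w) := by
  refine LipschitzWith.continuous (K := 1) fun s t => ?_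
  rw [ENNReal.coe_one, one_mul, edist_dist, Real.dist_eq]
  exact edist_arc_le w s t

theorem zero_mem_arc : (0 : ℝ) ∈ Icc 0 (2 * Real.pi / 3) := ⟨le_rfl, two_pi_div_three_nonneg⟩

theorem end_mem_arc : 2 * Real.pi / 3 ∈ Icc 0 (2 * Real.pi / 3) := ⟨two_pi_div_three_nonneg, le_rfl⟩

theorem abs_cornerVertex_one : |cornerVertex 1| = √2 := by
  rw [cornerVertex_one, abs_of_pos (by positivity)]

theorem abs_cornerVertex_two : |cornerVertex 2| = √2 := by
  rw [cornerVertex_two, abs_neg, abs_of_pos (by positivity)]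

/-- A direction of an edge with block `{1, 2}` at a vertex where `2` precedes `1`, in a cell with
`w 1 < w 2`, represents the first endpoint of the arcs. The letters are shifted to start at `0`. -/
theorem toLink_eq_arc_zero {a : PreLink theVertex} {w : Equiv.Perm (Fin 3)} (hw : w 0 < w 1)
    (ha : a.cell 0 < a.cell 1) (hd : a.dir 2 = 0) (hb : |(a.base : E 3) 2| = √2)
    (hs : (a.base : E 3) 1 - (a.base : E 3) 0 = √2) : toLink a = arc w 0 := by
  rw [arc_of_mem w zero_mem_arc]
  refine LinkRel.toLink_eq (l := 2) (i := 0) (j := 1) (by decide) (by decide) (by decide)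
    ⟨hd, arcDir_zero_apply_two, hb, abs_cornerVertex_two, ?_, iff_of_true ha hw⟩
  change _ = cornerVertex 0 - cornerVertex 1
  rw [cornerVertex_zero, cornerVertex_one]
  linarith

/-- The same for the block `{1, 3}` and the second endpoint. -/
theorem toLink_eq_arc_end {a : PreLink theVertex} {w : Equiv.Perm (Fin 3)} (hw : w 0 < w 2)
    (ha : a.cell 0 < a.cell 2) (hd : a.dir 1 = 0) (hb : |(a.base : E 3) 1| = √2)
    (hs : (a.base : E 3) 0 - (a.base : E 3) 2 = √2) : toLink a = arc w (2 * Real.pi / 3) := by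
  rw [arc_of_mem w end_mem_arc]
  refine LinkRel.toLink_eq (l := 1) (i := 0) (j := 2) (by decide) (by decide) (by decide)
    ⟨hd, arcDir_end_apply_one, hb, abs_cornerVertex_one, ?_, iff_of_true ha hw⟩
  change _ = cornerVertex 0 - cornerVertex 2
  rw [cornerVertex_zero, cornerVertex_two]
  linarith

theorem arc_zero_eq {w w' : Equiv.Perm (Fin 3)} (hw : w 0 < w 1) (hw' : w' 0 < w' 1) :
    arc w 0 = arc w' 0 := by
  rw [arc_of_mem w zero_mem_arc]
  refine toLink_eq_arc_zero hw' hw arcDir_zero_apply_two abs_cornerVertex_two ?_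
  change cornerVertex 1 - cornerVertex 0 = √2
  rw [cornerVertex_zero, cornerVertex_one, sub_zero]

theorem arc_end_eq {w w' : Equiv.Perm (Fin 3)} (hw : w 0 < w 2) (hw' : w' 0 < w' 2) :
    arc w (2 * Real.pi / 3) = arc w' (2 * Real.pi / 3) := by
  rw [arc_of_mem w end_mem_arc]
  refine toLink_eq_arc_end hw' hw arcDir_end_apply_one abs_cornerVertex_one ?_
  change cornerVertex 0 - cornerVertex 2 = √2
  rw [cornerVertex_zero, cornerVertex_two]
  ring

/-- The data of an edge direction in coordinates. -/
theorem edgeDirection_coords {a : PreLink theVertex} {u : Equiv.Perm (Fin 3)} {k : Fin (3 - 1)}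
    {r : ℝ} {i j l : Fin 3} (hui : u (lo k) = i) (huj : u (hi k) = j) (hli : l ≠ i) (hlj : l ≠ j)
    (hb : (a.base : E 3) = vertex u) (hd : a.dir = r • (vertex (u * simple k) - vertex u)) :
    a.dir l = 0 ∧ |(a.base : E 3) l| = √2 ∧ (a.base : E 3) i - (a.base : E 3) j = √2 := by
  have key : ∀ (u : Equiv.Perm (Fin 3)) (k : Fin (3 - 1)) (l : Fin 3), l ≠ u (lo k) →
      l ≠ u (hi k) → (u * simple k : Equiv.Perm (Fin 3))⁻¹ l = u⁻¹ l ∧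
        (u⁻¹ l = 0 ∨ u⁻¹ l = 2) ∧
        ((u⁻¹ (u (hi k)) : Fin 3) : ℕ) = (u⁻¹ (u (lo k)) : Fin 3) + 1 := by decide +kernel
  subst hui huj
  obtain ⟨h1, h2, h3⟩ := key u k l hli hlj
  refine ⟨?_, ?_, ?_⟩
  · rw [hd]
    simp only [PiLp.smul_apply, PiLp.sub_apply, smul_eq_mul]
    rw [vertex_apply, vertex_apply, h1, sub_self, mul_zero]
  · rw [hb, vertex_apply, abs_mul, abs_of_pos (by positivity : 0 < √2)]
    rcases h2 with h | h <;> rw [h] <;> norm_num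
  · rw [hb, vertex_apply, vertex_apply, h3]
    push_cast
    ring

theorem isYPlus_iff (y : Link theVertex) : IsYPlus 0 1 y ↔ y = arc 1 0 := by
  constructor
  · rintro ⟨w, u, k, ⟨a, rfl, rfl, hb, r, -, hd⟩, hw, hlo, hhi⟩
    obtain ⟨h1, h2, h3⟩ := edgeDirection_coords (l := 2) hlo hhi (by decide) (by decide) hb hd
    exact toLink_eq_arc_zero (by decide) hw h1 h2 h3
  · rintro rfl
    refine ⟨1, Equiv.swap 0 1, 0, ⟨_, (arc_of_mem 1 zero_mem_arc).symm, rfl, rfl, 1 / 2,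
      by norm_num, ?_⟩, by decide, by decide, by decide⟩
    have hu : Equiv.swap (0 : Fin 3) 1 * simple (n := 3) 0 = 1 := by decide
    have e0 : vertex (1 : Equiv.Perm (Fin 3)) 0 = √2 := by simp [vertex_apply]
    have e1 : vertex (1 : Equiv.Perm (Fin 3)) 1 = 0 := by simp [vertex_apply]
    have e2 : vertex (1 : Equiv.Perm (Fin 3)) 2 = -√2 := by simp [vertex_apply]; ring
    rw [hu]
    change arcDir 0 = (1 / 2 : ℝ) • (vertex 1 - cornerVertex)
    refine ext_of_ne (l := 0) (i := 1) (j := 2) (by decide) (by decide) (by decide) ?_ ?_ ?_ <;>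
      simp only [PiLp.smul_apply, PiLp.sub_apply, smul_eq_mul, arcDir_zero_apply_zero,
        arcDir_zero_apply_one, arcDir_zero_apply_two, cornerVertex_zero, cornerVertex_one,
        cornerVertex_two, e0, e1, e2] <;> ring

theorem isYMinus_iff (y : Link theVertex) : IsYMinus 0 2 y ↔ y = arc 1 (2 * Real.pi / 3) := by
  constructor
  · rintro ⟨w, u, k, ⟨a, rfl, rfl, hb, r, -, hd⟩, hw, hlo, hhi⟩
    obtain ⟨h1, h2, h3⟩ := edgeDirection_coords (l := 1) hlo hhi (by decide) (by decide) hb hd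
    exact toLink_eq_arc_end (by decide) hw h1 h2 h3
  · rintro rfl
    refine ⟨1, Equiv.swap 0 1, 1, ⟨_, (arc_of_mem 1 end_mem_arc).symm, rfl, rfl, 1 / 2,
      by norm_num, ?_⟩, by decide, by decide, by decide⟩
    set u : Equiv.Perm (Fin 3) := Equiv.swap (0 : Fin 3) 1 * simple (n := 3) 1 with hu
    have e0 : vertex u 0 = -√2 := by
      rw [vertex_apply, show u⁻¹ 0 = 2 by decide]; simp; ring
    have e1 : vertex u 1 = √2 := by
      rw [vertex_apply, show u⁻¹ 1 = 0 by decide]; simp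
    have e2 : vertex u 2 = 0 := by
      rw [vertex_apply, show u⁻¹ 2 = 1 by decide]; simp
    change arcDir (2 * Real.pi / 3) = (1 / 2 : ℝ) • (vertex u - cornerVertex)
    refine ext_of_ne (l := 0) (i := 1) (j := 2) (by decide) (by decide) (by decide) ?_ ?_ ?_ <;>
      simp only [PiLp.smul_apply, PiLp.sub_apply, smul_eq_mul, arcDir_end_apply_zero,
        arcDir_end_apply_one, arcDir_end_apply_two, cornerVertex_zero, cornerVertex_one,
        cornerVertex_two, e0, e1, e2] <;> ring

/-- The directions at the corner `213` are those of the arc. -/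
theorem exists_dir_eq_arcDir {a : PreLink theVertex} (hb : (a.base : E 3) = cornerVertex) :
    ∃ s ∈ Icc 0 (2 * Real.pi / 3), a.dir = arcDir s := by
  have hsum := a.dir_sum
  have hsq := a.dir_sq
  have h1 : a.dir 1 ≤ 0 := a.dir_nonpos (by rw [hb, cornerVertex_one])
  have h2 : 0 ≤ a.dir 2 := a.dir_nonneg (by rw [hb, cornerVertex_two])
  -- `c` and `d` are the coordinates of the direction in the orthonormal basis defining `arcDir`.
  set c : ℝ := (a.dir 0 - a.dir 1) * (√2 / 2) with hc
  set d : ℝ := a.dir 2 * (√6 / 2) with hd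
  have h6 : 0 < √6 := by positivity
  have h2' : 0 < √2 := by positivity
  have hd0 : 0 ≤ d := by positivity
  have hc2 : c ^ 2 = (a.dir 0 - a.dir 1) ^ 2 / 2 := by
    linear_combination (a.dir 0 - a.dir 1) ^ 2 / 4 * sqrt_two_mul_self
  have hd2 : d ^ 2 = a.dir 2 ^ 2 * (3 / 2) := by
    linear_combination a.dir 2 ^ 2 / 4 * sqrt_six_mul_self
  have hcd : c ^ 2 + d ^ 2 = 1 := by
    rw [hc2, hd2, show a.dir 2 = -(a.dir 0) - a.dir 1 by linarith]
    rw [show a.dir 2 = -(a.dir 0) - a.dir 1 by linarith] at hsq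
    linarith
  have hc1 : |c| ≤ 1 := abs_le_one_iff_mul_self_le_one.2 (by nlinarith)
  have hc1' := abs_le.1 hc1
  -- The direction points into the hexagon.
  have hcge : -(1 / 2) ≤ c := by
    by_contra hlt
    have hneg : a.dir 0 - a.dir 1 < 0 := by nlinarith
    have h0 : a.dir 0 - a.dir 1 ≥ -a.dir 2 := by linarith
    nlinarith
  refine ⟨Real.arccos c, ⟨Real.arccos_nonneg _, ?_⟩, ?_⟩
  · have : 2 * Real.pi / 3 = Real.arccos (-(1 / 2)) := by
      rw [← cos_two_pi_div_three, Real.arccos_cos two_pi_div_three_nonneg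
        (by linarith [Real.pi_pos])]
    rw [this]
    exact Real.arccos_le_arccos hcge
  · have hsin : Real.sin (Real.arccos c) = d := by
      rw [Real.sin_arccos, show 1 - c ^ 2 = d ^ 2 by linarith, Real.sqrt_sq hd0]
    refine ext_of_ne (l := 0) (i := 1) (j := 2) (by decide) (by decide) (by decide) ?_ ?_ ?_ <;>
      simp only [arcDir_apply_zero, arcDir_apply_one, arcDir_apply_two, hsin,
        Real.cos_arccos hc1'.1 hc1'.2] <;> rw [hd]
    · rw [hc]
      linear_combination hsum / 2 - (a.dir 0 - a.dir 1) / 4 * sqrt_two_mul_self +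
        a.dir 2 / 12 * sqrt_six_mul_self
    · rw [hc]
      linear_combination hsum / 2 + (a.dir 0 - a.dir 1) / 4 * sqrt_two_mul_self +
        a.dir 2 / 12 * sqrt_six_mul_self
    · linear_combination -a.dir 2 / 6 * sqrt_six_mul_self

theorem linkCorner_eq (w : Equiv.Perm (Fin 3)) :
    linkCorner theVertex w (Equiv.swap 0 1) = arc w '' Icc 0 (2 * Real.pi / 3) := by
  ext y
  constructor
  · rintro ⟨a, rfl, rfl, hb⟩
    obtain ⟨s, hs, hd⟩ := exists_dir_eq_arcDir hb
    refine ⟨s, hs, ?_⟩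
    rw [arc_of_mem _ hs]
    exact congrArg toLink (PreLink.ext_of_eq rfl (Subtype.ext hb.symm) hd.symm)
  · rintro ⟨s, hs, rfl⟩
    exact ⟨_, (arc_of_mem w hs).symm, rfl, rfl⟩

/-- At the corner `213`, only the two ends of the arc are involved in identifications. -/
theorem LinkRel.dir_eq_or {l i j : Fin 3}
    {a b : PreLink theVertex} (h : LinkRel l i j a b) (hb : (a.base : E 3) = cornerVertex) :
    a.dir = arcDir 0 ∨ a.dir = arcDir (2 * Real.pi / 3) := by
  obtain ⟨ha, -, hl, -, -, -⟩ := h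
  obtain rfl | rfl | rfl : l = 0 ∨ l = 1 ∨ l = 2 := by omega
  · rw [hb, cornerVertex_zero, abs_zero] at hl
    exact absurd hl (by positivity)
  · right
    have := a.dir_eq_of_edge (l := 1) (i := 0) (j := 2) (by decide) (by decide) (by decide) ha hl
      (by rw [hb, cornerVertex_zero, cornerVertex_two]; ring)
    exact ext_of_ne (l := 1) (i := 0) (j := 2) (by decide) (by decide) (by decide)
      (ha.trans arcDir_end_apply_one.symm) (this.1.trans arcDir_end_apply_zero.symm)
      (this.2.trans arcDir_end_apply_two.symm)
  · left
    have := a.dir_eq_of_edge (l := 2) (i := 1) (j := 0) (by decide) (by decide) (by decide) ha hl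
      (by rw [hb, cornerVertex_zero, cornerVertex_one]; ring)
    exact ext_of_ne (l := 2) (i := 1) (j := 0) (by decide) (by decide) (by decide)
      (ha.trans arcDir_zero_apply_two.symm) (this.1.trans arcDir_zero_apply_one.symm)
      (this.2.trans arcDir_zero_apply_zero.symm)

theorem arc_inter_arc :
    arc 1 '' Icc 0 (2 * Real.pi / 3) ∩ arc (Equiv.swap 1 2) '' Icc 0 (2 * Real.pi / 3) =
      {arc 1 0, arc 1 (2 * Real.pi / 3)} := by
  ext y
  constructor
  · rintro ⟨⟨s, hs, rfl⟩, s', hs', h⟩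
    rw [arc_of_mem _ hs, arc_of_mem _ hs'] at h
    rcases eq_or_linkRel_of_toLink_eq h with h | ⟨l, i, j, -, -, -, h⟩
    · have : Equiv.swap (1 : Fin 3) 2 = 1 := congrArg PreLink.cell h
      exact absurd this (by decide)
    · rw [arc_of_mem _ hs, arc_of_mem _ zero_mem_arc, arc_of_mem _ end_mem_arc]
      rcases h.symm.dir_eq_or rfl with h | h
      · exact Or.inl (congrArg toLink (PreLink.ext_of_eq rfl rfl h))
      · exact Or.inr (congrArg toLink (PreLink.ext_of_eq rfl rfl h))
  · rintro (rfl | rfl)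
    · exact ⟨⟨0, zero_mem_arc, rfl⟩, 0, zero_mem_arc, arc_zero_eq (by decide) (by decide)⟩
    · exact ⟨⟨_, end_mem_arc, rfl⟩, _, end_mem_arc, arc_end_eq (by decide) (by decide)⟩

/-! ### Lipschitz functions on the link -/

theorem abs_angle_sub_angle_le (x y z : E 3) :
    |InnerProductGeometry.angle x z - InnerProductGeometry.angle y z| ≤
      InnerProductGeometry.angle x y := by
  have h1 := InnerProductGeometry.angle_le_angle_add_angle x y z
  have h2 := InnerProductGeometry.angle_le_angle_add_angle y x z
  rw [InnerProductGeometry.angle_comm y x] at h2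
  rw [abs_le]
  constructor <;> linarith

/-- On the edges of the link ending in the first endpoint of the arcs, the distance from this point;
on the other edges, the constant `2π/3`. -/
def startDist (a : PreLink theVertex) : ℝ :=
  if a.cell 0 < a.cell 1 ∧ (a.base : E 3) 1 - (a.base : E 3) 0 = √2 then
    InnerProductGeometry.angle a.dir (arcDir 0) else 2 * Real.pi / 3

theorem startDist_eq_of_linkRel (a b : PreLink theVertex) (l i j : Fin 3) (hli : l ≠ i)
    (hlj : l ≠ j) (hij : i < j) (h : LinkRel l i j a b) : startDist a = startDist b := by
  have h2 : (0 : ℝ) < √2 := by positivity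
  by_cases hl : l = 2
  · subst hl
    obtain ⟨rfl, rfl⟩ : i = 0 ∧ j = 1 := by omega
    simp only [startDist, h.dir_eq hli hlj hij.ne, h.2.2.2.2.2,
      show (a.base : E 3) 1 - (a.base : E 3) 0 = (b.base : E 3) 1 - (b.base : E 3) 0 by
        linarith [h.2.2.2.2.1]]
  -- Such a direction is the other endpoint of an edge of the link.
  · have key : ∀ a : PreLink theVertex, a.dir l = 0 → |(a.base : E 3) l| = √2 →
        startDist a = 2 * Real.pi / 3 := by
      intro a ha hal
      rw [startDist]
      split_ifs with hc
      · have hs := sum_eq_zero_of_mem a.base.2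
        have h0 := abs_le.1 (abs_le_of_mem a.base.2 0)
        have h1 := abs_le.1 (abs_le_of_mem a.base.2 1)
        have hinner : inner ℝ a.dir (arcDir 0) = -(1 / 2) := by
          rw [inner_eq, arcDir_zero_apply_zero, arcDir_zero_apply_one, arcDir_zero_apply_two]
          have hl' : l = 0 ∨ l = 1 := by omega
          rcases hl' with rfl | rfl
          · have := a.dir_eq_of_edge (l := 0) (i := 2) (j := 1) (by decide) (by decide) (by decide)
              ha hal (by rcases (abs_eq h2.le).1 hal with h | h <;> linarith [hc.2])
            rw [ha, this.2]
            linear_combination -sqrt_two_mul_self / 4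
          · have := a.dir_eq_of_edge (l := 1) (i := 0) (j := 2) (by decide) (by decide) (by decide)
              ha hal (by rcases (abs_eq h2.le).1 hal with h | h <;> linarith [hc.2])
            rw [ha, this.1]
            linear_combination -sqrt_two_mul_self / 4
        rw [InnerProductGeometry.angle, hinner, a.norm_dir, norm_arcDir, mul_one, div_one,
          ← cos_two_pi_div_three, Real.arccos_cos two_pi_div_three_nonneg
            (by linarith [Real.pi_pos])]
      · rfl
    rw [key a h.1 h.2.2.1, key b h.2.1 h.2.2.2.1]

theorem ofReal_startDist_le_edist (a b : PreLink theVertex) :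
    ENNReal.ofReal |startDist a - startDist b| ≤ edist (toLink a) (toLink b) := by
  have := edist_linkLift_le startDist_eq_of_linkRel (fun a b hc hb => ?_) (toLink a) (toLink b)
  · rwa [edist_dist, Real.dist_eq] at this
  · rw [edist_dist, Real.dist_eq]
    refine ENNReal.ofReal_le_ofReal ?_
    rw [startDist, startDist, hc, hb]
    split_ifs
    · exact abs_angle_sub_angle_le _ _ _
    · simpa using InnerProductGeometry.angle_nonneg _ _

theorem startDist_arcPreLink {w : Equiv.Perm (Fin 3)} (hw : w 0 < w 1)
    (s : Icc (0 : ℝ) (2 * Real.pi / 3)) : startDist (arcPreLink w s) = s := by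
  have hc : cornerVertex 1 - cornerVertex 0 = √2 := by
    rw [cornerVertex_zero, cornerVertex_one, sub_zero]
  rw [startDist, if_pos ⟨hw, hc⟩]
  change InnerProductGeometry.angle (arcDir s) (arcDir 0) = _
  rw [angle_arcDir s.2 zero_mem_arc, sub_zero, abs_of_nonneg s.2.1]

/-- The arc cannot be shortened in the link: `startDist` grows along it with speed one. -/
theorem isGeodesic_arc {w : Equiv.Perm (Fin 3)} (hw : w 0 < w 1) :
    IsGeodesic (arc w) (2 * Real.pi / 3) (arc w 0) (arc w (2 * Real.pi / 3)) := by
  refine isGeodesic_of_le two_pi_div_three_nonneg (fun s _ t _ => edist_arc_le w s t) ?_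
  rw [arc_of_mem w zero_mem_arc, arc_of_mem w end_mem_arc]
  refine le_trans (le_of_eq ?_) (ofReal_startDist_le_edist _ _)
  rw [startDist_arcPreLink hw, startDist_arcPreLink hw]
  congr 1
  rw [zero_sub, abs_neg, abs_of_nonneg two_pi_div_three_nonneg]

open Classical in
/-- On the arc in the cell `w`, the distance to the nearest endpoint; zero on the other edges of the
link. -/
def arcTent (w : Equiv.Perm (Fin 3)) (a : PreLink theVertex) : ℝ :=
  if a.cell = w ∧ (a.base : E 3) = cornerVertex then
    min (InnerProductGeometry.angle a.dir (arcDir 0))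
      (InnerProductGeometry.angle a.dir (arcDir (2 * Real.pi / 3))) else 0

theorem arcTent_eq_zero {l i j : Fin 3} {a b : PreLink theVertex} (h : LinkRel l i j a b)
    (w : Equiv.Perm (Fin 3)) : arcTent w a = 0 := by
  have h0 : ∀ s, InnerProductGeometry.angle (arcDir s) (arcDir s) = 0 := fun s =>
    InnerProductGeometry.angle_self (norm_ne_zero_iff.1 (by rw [norm_arcDir]; exact one_ne_zero))
  rw [arcTent]
  split_ifs with hc
  · rcases h.dir_eq_or hc.2 with h | h <;> rw [h, h0]
    · exact min_eq_left (InnerProductGeometry.angle_nonneg _ _)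
    · exact min_eq_right (InnerProductGeometry.angle_nonneg _ _)
  · rfl

/-- The difference of the tents over the two arcs. Near an endpoint of the arcs it is, up to a sign
and a constant, the arc length along the closed curve formed by them. -/
def arcTentDiff (a : PreLink theVertex) : ℝ := arcTent 1 a - arcTent (Equiv.swap 1 2) a

theorem abs_min_sub_min_le {a b c d M : ℝ} (h : |a - c| ≤ M) (h' : |b - d| ≤ M) :
    |min a b - min c d| ≤ M :=
  (abs_min_sub_min_le_max a b c d).trans (max_le h h')

theorem abs_arcTentDiff_sub_le {a b : PreLink theVertex} (hc : a.cell = b.cell)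
    (hb : a.base = b.base) :
    |arcTentDiff a - arcTentDiff b| ≤ InnerProductGeometry.angle a.dir b.dir := by
  have hne : ¬ (Equiv.swap (1 : Fin 3) 2 = 1) := by decide
  have h : ∀ w, |arcTent w a - arcTent w b| ≤ InnerProductGeometry.angle a.dir b.dir := by
    intro w
    rw [arcTent, arcTent, hc, hb]
    split_ifs
    · exact abs_min_sub_min_le (abs_angle_sub_angle_le _ _ _) (abs_angle_sub_angle_le _ _ _)
    · simpa using InnerProductGeometry.angle_nonneg _ _
  have hz : ∀ (a : PreLink theVertex) (w : Equiv.Perm (Fin 3)), a.cell ≠ w → arcTent w a = 0 :=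
    fun a w h => if_neg fun h' => h h'.1
  rw [arcTentDiff, arcTentDiff]
  by_cases h1 : b.cell = 1
  · rw [hz a (Equiv.swap 1 2) (by rw [hc, h1]; exact fun h => hne h.symm),
      hz b (Equiv.swap 1 2) (by rw [h1]; exact fun h => hne h.symm), sub_zero, sub_zero]
    exact h 1
  · rw [hz a 1 (by rwa [hc]), hz b 1 h1, zero_sub, zero_sub, ← neg_sub', abs_neg]
    exact h _

theorem ofReal_arcTentDiff_le_edist (a b : PreLink theVertex) :
    ENNReal.ofReal |arcTentDiff a - arcTentDiff b| ≤ edist (toLink a) (toLink b) := by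
  have := edist_linkLift_le (F := arcTentDiff) (fun a b l i j _ _ _ h => ?_)
    (fun a b hc hb => ?_) (toLink a) (toLink b)
  · rwa [edist_dist, Real.dist_eq] at this
  · rw [arcTentDiff, arcTentDiff, arcTent_eq_zero h, arcTent_eq_zero h,
      arcTent_eq_zero h.symm, arcTent_eq_zero h.symm]
  · rw [edist_dist, Real.dist_eq]
    exact ENNReal.ofReal_le_ofReal (abs_arcTentDiff_sub_le hc hb)

theorem arcTent_arcPreLink (w : Equiv.Perm (Fin 3)) (s : Icc (0 : ℝ) (2 * Real.pi / 3)) :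
    arcTent w (arcPreLink w s) = min (s : ℝ) (2 * Real.pi / 3 - s) := by
  rw [arcTent, if_pos ⟨rfl, rfl⟩]
  change min (InnerProductGeometry.angle (arcDir s) _) (InnerProductGeometry.angle (arcDir s) _) = _
  rw [angle_arcDir s.2 zero_mem_arc, angle_arcDir s.2 end_mem_arc, sub_zero, abs_of_nonneg s.2.1,
    abs_of_nonpos (sub_nonpos.2 s.2.2), neg_sub]

theorem arcTentDiff_arcPreLink_one (s : Icc (0 : ℝ) (2 * Real.pi / 3)) :
    arcTentDiff (arcPreLink 1 s) = min (s : ℝ) (2 * Real.pi / 3 - s) := by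
  rw [arcTentDiff, arcTent_arcPreLink, arcTent, if_neg, sub_zero]
  exact fun h => absurd h.1.symm (by decide : ¬ (Equiv.swap (1 : Fin 3) 2 = 1))

theorem arcTentDiff_arcPreLink_swap (s : Icc (0 : ℝ) (2 * Real.pi / 3)) :
    arcTentDiff (arcPreLink (Equiv.swap 1 2) s) = -min (s : ℝ) (2 * Real.pi / 3 - s) := by
  rw [arcTentDiff, arcTent_arcPreLink, arcTent, if_neg, zero_sub]
  exact fun h => absurd h.1 (by decide : ¬ (Equiv.swap (1 : Fin 3) 2 = 1))

open Classical in
/-- The map to a circle which wraps the arc in the cell `1` once around and collapses all the other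
edges of the link to a point. -/
def collapse (a : PreLink theVertex) : AddCircle (2 * Real.pi / 3) :=
  if a.cell = 1 ∧ (a.base : E 3) = cornerVertex then
    (InnerProductGeometry.angle a.dir (arcDir 0) : ℝ) else 0

theorem collapse_eq_of_linkRel (a b : PreLink theVertex) (l i j : Fin 3) (_ : l ≠ i) (_ : l ≠ j)
    (_ : i < j) (h : LinkRel l i j a b) : collapse a = collapse b := by
  have key : ∀ a b : PreLink theVertex, LinkRel l i j a b → collapse a = 0 := by
    intro a b h
    rw [collapse]
    split_ifs with hc
    · rcases h.dir_eq_or hc.2 with h | h <;> rw [h]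
      · rw [angle_arcDir zero_mem_arc zero_mem_arc]; simp
      · rw [angle_arcDir end_mem_arc zero_mem_arc, sub_zero, abs_of_nonneg two_pi_div_three_nonneg]
        exact AddCircle.coe_period _
    · rfl
  rw [key a b h, key b a h.symm]

/-- The map of the link to the circle induced by `collapse`. -/
def linkCollapse : C(Link theVertex, AddCircle (2 * Real.pi / 3)) where
  toFun := linkLift collapse collapse_eq_of_linkRel
  continuous_toFun := by
    refine LipschitzWith.continuous (K := 1) fun x y => ?_
    rw [ENNReal.coe_one, one_mul]
    refine edist_linkLift_le collapse_eq_of_linkRel (fun a b hc hb => ?_) x y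
    rw [edist_dist]
    refine ENNReal.ofReal_le_ofReal ?_
    rw [collapse, collapse, hc, hb]
    split_ifs
    · rw [dist_eq_norm, ← AddCircle.coe_sub]
      refine le_trans ?_ (abs_angle_sub_angle_le a.dir b.dir (arcDir 0))
      exact QuotientAddGroup.norm_mk_le_norm
    · rw [dist_self]
      exact InnerProductGeometry.angle_nonneg _ _

theorem linkCollapse_toLink (a : PreLink theVertex) : linkCollapse (toLink a) = collapse a := rfl

theorem linkCollapse_arc_one {s : ℝ} (hs : s ∈ Icc 0 (2 * Real.pi / 3)) :
    linkCollapse (arc 1 s) = (s : AddCircle (2 * Real.pi / 3)) := by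
  rw [arc_of_mem 1 hs, linkCollapse_toLink, collapse, if_pos ⟨rfl, rfl⟩]
  change ((InnerProductGeometry.angle (arcDir s) (arcDir 0) : ℝ) : AddCircle (2 * Real.pi / 3)) = _
  rw [angle_arcDir hs zero_mem_arc, sub_zero, abs_of_nonneg hs.1]

theorem linkCollapse_arc_swap (s : ℝ) : linkCollapse (arc (Equiv.swap 1 2) s) = 0 := by
  rw [arc, linkCollapse_toLink]
  exact if_neg fun h => absurd h.1 (by decide : ¬ (Equiv.swap (1 : Fin 3) 2 = 1))

/-! ### The closed curve in the link -/

instance fact_four_pi_div_three_pos : Fact ((0 : ℝ) < 4 * Real.pi / 3) := ⟨by positivity⟩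

/-- The first arc followed by the second one in the reverse direction. -/
def loopFun (x : ℝ) : Link theVertex :=
  if x ≤ 2 * Real.pi / 3 then arc 1 x else arc (Equiv.swap 1 2) (4 * Real.pi / 3 - x)

theorem loopFun_zero_eq : loopFun 0 = loopFun (4 * Real.pi / 3) := by
  have hpi := Real.pi_pos
  rw [loopFun, loopFun, if_pos two_pi_div_three_nonneg, if_neg (by linarith), sub_self]
  exact arc_zero_eq (by decide) (by decide)

theorem continuous_loopFun : Continuous loopFun := by
  refine Continuous.if_le (continuous_arc 1)
    ((continuous_arc _).comp (continuous_const.sub continuous_id)) continuous_id continuous_const ?_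
  rintro x rfl
  change _ = arc _ (4 * Real.pi / 3 - 2 * Real.pi / 3)
  rw [show 4 * Real.pi / 3 - 2 * Real.pi / 3 = 2 * Real.pi / 3 by ring]
  exact arc_end_eq (by decide) (by decide)

/-- The closed curve of length `4π/3` formed by the two arcs. -/
def loop : C(AddCircle (4 * Real.pi / 3), Link theVertex) where
  toFun := AddCircle.liftIco (4 * Real.pi / 3) 0 loopFun
  continuous_toFun :=
    AddCircle.liftIco_zero_continuous loopFun_zero_eq continuous_loopFun.continuousOn

theorem loop_coe {x : ℝ} (hx : x ∈ Icc 0 (4 * Real.pi / 3)) : loop x = loopFun x := by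
  rcases hx.2.lt_or_eq with h | rfl
  · exact AddCircle.liftIco_zero_coe_apply (f := loopFun) ⟨hx.1, h⟩
  · rw [← loopFun_zero_eq, AddCircle.coe_period, ← AddCircle.coe_zero]
    exact AddCircle.liftIco_zero_coe_apply (f := loopFun) ⟨le_rfl, by positivity⟩

theorem loop_coe_of_le {x : ℝ} (hx : x ∈ Icc 0 (2 * Real.pi / 3)) : loop x = arc 1 x := by
  rw [loop_coe ⟨hx.1, by linarith [hx.2, Real.pi_pos]⟩, loopFun, if_pos hx.2]

theorem loop_coe_of_ge {x : ℝ} (hx : x ∈ Icc (2 * Real.pi / 3) (4 * Real.pi / 3)) :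
    loop x = arc (Equiv.swap 1 2) (4 * Real.pi / 3 - x) := by
  rw [loop_coe ⟨two_pi_div_three_nonneg.trans hx.1, hx.2⟩, loopFun]
  split_ifs with h
  · obtain rfl := le_antisymm h hx.1
    rw [show 4 * Real.pi / 3 - 2 * Real.pi / 3 = 2 * Real.pi / 3 by ring]
    exact arc_end_eq (by decide) (by decide)
  · rfl

theorem loop_coe_of_nonpos {x : ℝ} (hx : x ∈ Icc (-(2 * Real.pi / 3)) 0) :
    loop x = arc (Equiv.swap 1 2) (-x) := by
  rw [← AddCircle.coe_add_period, loop_coe_of_ge ⟨by linarith [hx.1], by linarith [hx.2]⟩]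
  congr 1
  ring

theorem range_loop : Set.range loop =
    arc 1 '' Icc 0 (2 * Real.pi / 3) ∪ arc (Equiv.swap 1 2) '' Icc 0 (2 * Real.pi / 3) := by
  have hpi := Real.pi_pos
  ext y
  constructor
  · rintro ⟨θ, rfl⟩
    have hθ : θ ∈ ((↑) : ℝ → AddCircle (4 * Real.pi / 3)) '' Ico 0 (0 + 4 * Real.pi / 3) := by
      rw [AddCircle.coe_image_Ico_eq]; trivial
    obtain ⟨x, hx, rfl⟩ := hθ
    rcases le_total x (2 * Real.pi / 3) with h | h
    · exact Or.inl ⟨x, ⟨hx.1, h⟩, (loop_coe_of_le ⟨hx.1, h⟩).symm⟩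
    · exact Or.inr ⟨4 * Real.pi / 3 - x, ⟨by linarith [hx.2], by linarith⟩,
        (loop_coe_of_ge ⟨h, by linarith [hx.2]⟩).symm⟩
  · rintro (⟨s, hs, rfl⟩ | ⟨s, hs, rfl⟩)
    · exact ⟨s, loop_coe_of_le hs⟩
    · refine ⟨((-s : ℝ) : AddCircle _), ?_⟩
      rw [loop_coe_of_nonpos ⟨by linarith [hs.2], by linarith [hs.1]⟩, neg_neg]

/-- To be a local isometry at a point of the circle can be checked on an interval of the line. -/
theorem exists_ball_of_interval {X : Type*} [PseudoEMetricSpace X] {L : ℝ} (hL : 0 < L)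
    {c : AddCircle L → X} {u v a : ℝ} (ha : a ∈ Ioo u v)
    (h : ∀ s ∈ Ioo u v, ∀ t ∈ Ioo u v, edist (c s) (c t) = ENNReal.ofReal |s - t|) :
    ∃ ε > 0, ∀ s ∈ Metric.ball (a : AddCircle L) ε, ∀ t ∈ Metric.ball (a : AddCircle L) ε,
      edist (c s) (c t) = edist s t := by
  set ε : ℝ := min (L / 4) (min (a - u) (v - a)) with hε
  have hε0 : 0 < ε := lt_min (by linarith) (lt_min (by linarith [ha.1]) (by linarith [ha.2]))
  have h1 : ε ≤ L / 4 := min_le_left _ _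
  have h2 : ε ≤ a - u := (min_le_right _ _).trans (min_le_left _ _)
  have h3 : ε ≤ v - a := (min_le_right _ _).trans (min_le_right _ _)
  have key : ∀ s ∈ Metric.ball (a : AddCircle L) ε,
      ∃ x : ℝ, (x : AddCircle L) = s ∧ |x - a| < ε := by
    intro s hs
    obtain ⟨x, rfl⟩ := QuotientAddGroup.mk_surjective s
    rw [Metric.mem_ball, dist_eq_norm] at hs
    change ‖(x : AddCircle L) - (a : AddCircle L)‖ < ε at hs
    rw [← AddCircle.coe_sub, AddCircle.norm_eq] at hs
    refine ⟨x - round (L⁻¹ * (x - a)) * L, ?_, ?_⟩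
    · rw [AddCircle.coe_sub, ← zsmul_eq_mul, AddCircle.coe_zsmul, AddCircle.coe_period, smul_zero,
        sub_zero]
    · rwa [sub_right_comm]
  refine ⟨ε, hε0, fun s hs t ht => ?_⟩
  obtain ⟨x, rfl, hx⟩ := key s hs
  obtain ⟨y, rfl, hy⟩ := key t ht
  rw [abs_lt] at hx hy
  rw [h x ⟨by linarith, by linarith⟩ y ⟨by linarith, by linarith⟩, edist_dist, dist_eq_norm,
    ← AddCircle.coe_sub, (AddCircle.norm_coe_eq_abs_iff L hL.ne').2]
  rw [abs_of_pos hL, abs_le]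
  constructor <;> linarith

/-- A path which is `1`-Lipschitz on both sides of `b` is `1`-Lipschitz. -/
theorem edist_le_of_sides {X : Type*} [PseudoEMetricSpace X] {γ : ℝ → X} {I : Set ℝ} {b : ℝ}
    (hb : b ∈ I)
    (hl : ∀ s ∈ I, ∀ t ∈ I, s ≤ b → t ≤ b → edist (γ s) (γ t) ≤ ENNReal.ofReal |s - t|)
    (hr : ∀ s ∈ I, ∀ t ∈ I, b ≤ s → b ≤ t → edist (γ s) (γ t) ≤ ENNReal.ofReal |s - t|) :
    ∀ s ∈ I, ∀ t ∈ I, edist (γ s) (γ t) ≤ ENNReal.ofReal |s - t| := by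
  have key : ∀ s ∈ I, ∀ t ∈ I, s ≤ b → b ≤ t → edist (γ s) (γ t) ≤ ENNReal.ofReal |s - t| := by
    intro s hs t ht hsb hbt
    refine (edist_triangle _ (γ b) _).trans ((add_le_add (hl s hs b hb hsb le_rfl)
      (hr b hb t ht le_rfl hbt)).trans (le_of_eq ?_))
    rw [← ENNReal.ofReal_add (abs_nonneg _) (abs_nonneg _), abs_of_nonpos (by linarith),
      abs_of_nonpos (by linarith), abs_of_nonpos (by linarith)]
    congr 1
    ring
  intro s hs t ht
  rcases le_total s b with h | h <;> rcases le_total t b with h' | h'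
  · exact hl s hs t ht h h'
  · exact key s hs t ht h h'
  · rw [edist_comm, abs_sub_comm]
    exact key t ht s hs h' h
  · exact hr s hs t ht h h'

/-- Away from the endpoints of the arcs the curve runs along one of the geodesics; near these
endpoints the function `arcTentDiff` shows that it does not take a shortcut. -/
theorem isClosedGeodesic_loop : IsClosedGeodesic loop := by
  have hpi := Real.pi_pos
  intro θ
  have hθ : θ ∈ ((↑) : ℝ → AddCircle (4 * Real.pi / 3)) ''
      Ico (-(Real.pi / 3)) (-(Real.pi / 3) + 4 * Real.pi / 3) := by
    rw [AddCircle.coe_image_Ico_eq]; trivial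
  obtain ⟨a, ⟨ha1, ha2⟩, rfl⟩ := hθ
  have hL : 0 < 4 * Real.pi / 3 := by positivity
  have hg1 := (isGeodesic_arc (w := 1) (by decide)).2.2.2
  have hg2 := (isGeodesic_arc (w := Equiv.swap 1 2) (by decide)).2.2.2
  have hcover : a ∈ Ioo (-(2 * Real.pi / 3)) 0 ∨ a ∈ Ioo (-(Real.pi / 3)) (Real.pi / 3) ∨
      a ∈ Ioo 0 (2 * Real.pi / 3) ∨ a ∈ Ioo (Real.pi / 3) Real.pi := by
    by_cases h1 : a < 0
    · exact Or.inl ⟨by linarith, h1⟩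
    by_cases h2 : a < Real.pi / 3
    · exact Or.inr (Or.inl ⟨by linarith, h2⟩)
    by_cases h3 : a < 2 * Real.pi / 3
    · exact Or.inr (Or.inr (Or.inl ⟨by linarith, h3⟩))
    · exact Or.inr (Or.inr (Or.inr ⟨by linarith, by linarith⟩))
  rcases hcover with ha | ha | ha | ha
  · refine exists_ball_of_interval hL ha fun s hs t ht => ?_
    rw [loop_coe_of_nonpos ⟨hs.1.le, hs.2.le⟩, loop_coe_of_nonpos ⟨ht.1.le, ht.2.le⟩,
      hg2 _ ⟨by linarith [hs.2], by linarith [hs.1]⟩ _ ⟨by linarith [ht.2], by linarith [ht.1]⟩]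
    rw [show -s - -t = -(s - t) by ring, abs_neg]
  · refine exists_ball_of_interval hL ha fun s hs t ht => le_antisymm ?_ ?_
    · refine edist_le_of_sides (γ := fun x : ℝ => loop x) (I := Ioo (-(Real.pi / 3)) (Real.pi / 3))
        (b := 0) ⟨by linarith, by linarith⟩ (fun s hs t ht h h' => ?_) (fun s hs t ht h h' => ?_)
        s hs t ht
      · rw [loop_coe_of_nonpos ⟨by linarith [hs.1], h⟩, loop_coe_of_nonpos ⟨by linarith [ht.1], h'⟩]
        refine (edist_arc_le _ _ _).trans (le_of_eq ?_)
        rw [show -s - -t = -(s - t) by ring, abs_neg]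
      · rw [loop_coe_of_le ⟨h, by linarith [hs.2]⟩, loop_coe_of_le ⟨h', by linarith [ht.2]⟩]
        exact edist_arc_le _ _ _
    · have key : ∀ s ∈ Ioo (-(Real.pi / 3)) (Real.pi / 3), ∃ x : PreLink theVertex,
          loop s = toLink x ∧ arcTentDiff x = s := by
        intro s hs
        rcases le_total s 0 with h | h
        · refine ⟨_, (loop_coe_of_nonpos ⟨by linarith [hs.1], h⟩).trans
            (arc_of_mem _ ⟨by linarith, by linarith [hs.1]⟩), ?_⟩
          rw [arcTentDiff_arcPreLink_swap, min_eq_left (by linarith [hs.1]), neg_neg]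
        · refine ⟨_, (loop_coe_of_le ⟨h, by linarith [hs.2]⟩).trans
            (arc_of_mem _ ⟨h, by linarith [hs.2]⟩), ?_⟩
          rw [arcTentDiff_arcPreLink_one, min_eq_left (by linarith [hs.2])]
      obtain ⟨x, hx, hx'⟩ := key s hs
      obtain ⟨y, hy, hy'⟩ := key t ht
      rw [hx, hy, ← hx', ← hy']
      exact ofReal_arcTentDiff_le_edist x y
  · refine exists_ball_of_interval hL ha fun s hs t ht => ?_
    rw [loop_coe_of_le ⟨hs.1.le, hs.2.le⟩, loop_coe_of_le ⟨ht.1.le, ht.2.le⟩,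
      hg1 _ ⟨hs.1.le, hs.2.le⟩ _ ⟨ht.1.le, ht.2.le⟩]
  · refine exists_ball_of_interval hL ha fun s hs t ht => le_antisymm ?_ ?_
    · refine edist_le_of_sides (γ := fun x : ℝ => loop x) (I := Ioo (Real.pi / 3) Real.pi)
        (b := 2 * Real.pi / 3) ⟨by linarith, by linarith⟩ (fun s hs t ht h h' => ?_)
        (fun s hs t ht h h' => ?_) s hs t ht
      · rw [loop_coe_of_le ⟨by linarith [hs.1], h⟩, loop_coe_of_le ⟨by linarith [ht.1], h'⟩]
        exact edist_arc_le _ _ _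
      · rw [loop_coe_of_ge ⟨h, by linarith [hs.2]⟩, loop_coe_of_ge ⟨h', by linarith [ht.2]⟩]
        refine (edist_arc_le _ _ _).trans (le_of_eq ?_)
        rw [show 4 * Real.pi / 3 - s - (4 * Real.pi / 3 - t) = -(s - t) by ring, abs_neg]
    · have key : ∀ s ∈ Ioo (Real.pi / 3) Real.pi, ∃ x : PreLink theVertex,
          loop s = toLink x ∧ arcTentDiff x = 2 * Real.pi / 3 - s := by
        intro s hs
        rcases le_total s (2 * Real.pi / 3) with h | h
        · refine ⟨_, (loop_coe_of_le ⟨by linarith [hs.1], h⟩).trans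
            (arc_of_mem _ ⟨by linarith [hs.1], h⟩), ?_⟩
          rw [arcTentDiff_arcPreLink_one, min_eq_right (by linarith [hs.1])]
        · refine ⟨_, (loop_coe_of_ge ⟨h, by linarith [hs.2]⟩).trans
            (arc_of_mem _ ⟨by linarith [hs.2], by linarith⟩), ?_⟩
          rw [arcTentDiff_arcPreLink_swap, min_eq_right (by linarith [hs.2])]
          ring
      obtain ⟨x, hx, hx'⟩ := key s hs
      obtain ⟨y, hy, hy'⟩ := key t ht
      rw [hx, hy]
      refine le_trans (le_of_eq ?_) (ofReal_arcTentDiff_le_edist x y)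
      rw [hx', hy', show 2 * Real.pi / 3 - s - (2 * Real.pi / 3 - t) = -(s - t) by ring, abs_neg]

/-! ### The curve is not null-homotopic -/

/-- A null-homotopic map to a circle lifts to the line. -/
theorem exists_lift_of_nullhomotopic {A : Type*} [TopologicalSpace A] {p : ℝ}
    {f : C(A, AddCircle p)} (hf : f.Nullhomotopic) :
    ∃ g : C(A, ℝ), ∀ a, (g a : AddCircle p) = f a := by
  obtain ⟨y, hy⟩ := hf
  obtain ⟨H⟩ := hy.symm
  obtain ⟨x, rfl⟩ := QuotientAddGroup.mk_surjective y
  have cov := AddCircle.isCoveringMap_coe p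
  let G := cov.liftHomotopy H.toContinuousMap (ContinuousMap.const A x) (fun a => by simp)
  refine ⟨⟨fun a => G (1, a), by fun_prop⟩, fun a => ?_⟩
  have := congrFun (cov.liftHomotopy_lifts H.toContinuousMap (ContinuousMap.const A x)
    (fun a => by simp)) (1, a)
  simpa using this

/-- The collapse of the link to a circle takes the closed curve to a curve of degree one. -/
theorem not_nullhomotopic_loop : ¬ loop.Nullhomotopic := by
  intro h
  have hpi := Real.pi_pos
  obtain ⟨g, hg⟩ := exists_lift_of_nullhomotopic (h.comp_right linkCollapse)
  -- The image of the curve in the circle lifts to the path `x ↦ min x (2π/3)`, which is not closed.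
  have key : ∀ x ∈ Icc 0 (4 * Real.pi / 3),
      (g (x : AddCircle (4 * Real.pi / 3)) : AddCircle (2 * Real.pi / 3)) =
        (min x (2 * Real.pi / 3) : ℝ) := by
    intro x hx
    rw [hg]
    change linkCollapse (loop x) = _
    rcases le_total x (2 * Real.pi / 3) with h | h
    · rw [loop_coe_of_le ⟨hx.1, h⟩, linkCollapse_arc_one ⟨hx.1, h⟩, min_eq_left h]
    · rw [loop_coe_of_ge ⟨h, hx.2⟩, linkCollapse_arc_swap, min_eq_right h, AddCircle.coe_period]
  have h0 : (0 : ℝ) ∈ Icc 0 (4 * Real.pi / 3) := ⟨le_rfl, by positivity⟩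
  have h1 : 4 * Real.pi / 3 ∈ Icc 0 (4 * Real.pi / 3) := ⟨by positivity, le_rfl⟩
  set g0 : ℝ := g ((0 : ℝ) : AddCircle (4 * Real.pi / 3)) with hg0
  have hg0' : (g0 : AddCircle (2 * Real.pi / 3)) = 0 := by
    rw [hg0, key 0 h0, min_eq_left two_pi_div_three_nonneg, AddCircle.coe_zero]
  have heq := (AddCircle.isCoveringMap_coe (2 * Real.pi / 3)).eqOn_of_comp_eqOn
    (s := Icc 0 (4 * Real.pi / 3)) isPreconnected_Icc
    (g₁ := fun x : ℝ => g (x : AddCircle (4 * Real.pi / 3)))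
    (g₂ := fun x : ℝ => min x (2 * Real.pi / 3) + g0)
    (g.continuous.comp (AddCircle.continuous_mk' _)).continuousOn
    (by fun_prop) (fun x hx => by
      simp only [Function.comp_apply]
      rw [key x hx, AddCircle.coe_add, hg0', add_zero]) h0
    (by rw [min_eq_left two_pi_div_three_nonneg, zero_add])
  have := heq h1
  simp only [AddCircle.coe_period] at this
  rw [min_eq_right (by linarith), hg0, AddCircle.coe_zero] at this
  linarith

end BEER

end

theorem mainTheorem5 :
    ¬ BEER.IsLocallyCAT0 (BEER.Omega 3) ∧
    ∃ ω : BEER.Omega 3, (∀ p : BEER.Omega 3, BEER.IsVertex p ↔ p = ω) ∧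
      (∃ y₁ y₂ : BEER.Link ω,
        (∀ y : BEER.Link ω, BEER.IsYPlus 0 1 y ↔ y = y₁) ∧
        (∀ y : BEER.Link ω, BEER.IsYMinus 0 2 y ↔ y = y₂) ∧
        ∃ A₁ A₂ : Set (BEER.Link ω),
          A₁ = BEER.linkCorner ω 1 (Equiv.swap 0 1) ∧
          A₂ = BEER.linkCorner ω (Equiv.swap 1 2) (Equiv.swap 0 1) ∧
          BEER.IsArc A₁ (2 * Real.pi / 3) y₁ y₂ ∧
          BEER.IsArc A₂ (2 * Real.pi / 3) y₁ y₂ ∧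
          A₁ ∩ A₂ = {y₁, y₂} ∧
          ∃ c : C(AddCircle (4 * Real.pi / 3), BEER.Link ω),
            BEER.IsClosedGeodesic c ∧ ¬ c.Nullhomotopic ∧ Set.range c = A₁ ∪ A₂) ∧
      4 * Real.pi / 3 < 2 * Real.pi ∧
      ¬ BEER.LinkCondition 3 := by
  have hlt : 4 * Real.pi / 3 < 2 * Real.pi := by linarith [Real.pi_pos]
  refine ⟨BEER.not_isLocallyCAT0, BEER.theVertex, BEER.isVertex_iff,
    ⟨_, _, BEER.isYPlus_iff, BEER.isYMinus_iff, _, _, rfl, rfl, ?_, ?_, ?_,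
      BEER.loop, BEER.isClosedGeodesic_loop, BEER.not_nullhomotopic_loop, ?_⟩, hlt, fun h => ?_⟩
  · exact ⟨_, BEER.isGeodesic_arc (by decide), (BEER.linkCorner_eq 1).symm⟩
  · have hgeo := BEER.isGeodesic_arc (w := Equiv.swap 1 2) (by decide)
    rw [BEER.arc_zero_eq (w' := 1) (by decide) (by decide),
      BEER.arc_end_eq (w' := 1) (by decide) (by decide)] at hgeo
    exact ⟨_, hgeo, (BEER.linkCorner_eq _).symm⟩
  · rw [BEER.linkCorner_eq, BEER.linkCorner_eq]
    exact BEER.arc_inter_arc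
  · rw [BEER.linkCorner_eq, BEER.linkCorner_eq]
    exact BEER.range_loop
  · exact hlt.not_ge (h BEER.theVertex ((BEER.isVertex_iff _).2 rfl) _ (by positivity) BEER.loop
      BEER.isClosedGeodesic_loop BEER.not_nullhomotopic_loop)
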